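/- Notation. For $1\le q\le\infty$ let $\ell^n_q$ be $\mathbb C^n$ with the norm $\|\cdot\|_q$ and $B_{\ell^n_q}$ its open unit ball. For a complex Banach space $X\neq\{0\}$, $1\le p<\infty$ and $\lambda\ge 1$, the $\lambda_p$-Bohr radius $K^p(B_{\ell^n_q},X,\lambda)$ is the supremum of all $r\ge 0$ such that $$\sup_{z\in rB_{\ell^n_q}}\ \sum_{\alpha\in\mathbb N_0^n}\|x_\alpha z^\alpha\|_X^p\ \le\ \lambda\,\sup_{z\in B_{\ell^n_q}}\Big\|\sum_{\alpha\in\mathbb N_0^n}x_\alpha z^\alpha\Big\|_X^p$$ for all holomorphic functions $f(z)=\sum_{\alpha}x_\alpha z^\alpha$ on $B_{\ell^n_q}$ with values in $X$. Let $\pi_1(\mathrm{Id}_X)$ be the best constant $c$ such that $\sum_{j}\|x_j\|\le c\,\sup_{x^*\in B_{X^*}}\sum_{j}|x^*(x_j)|$ for all finite families $(x_j)$ in $X$. For $s\in[1,\infty]$ let $s'$ denote the conjugate exponent, $1/s+1/s'=1$, and put $1/\infty=0$. Theorem. There is a universal constant $B>0$ such that the following holds. Let $X\neq\{0\}$ be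 a finite-dimensional complex Banach space and put $$C=e^{-1}\inf_{m\in\mathbb N}\pi_1(\mathrm{Id}_X)^{-1/m},$$ where $\mathbb N=\{1,2,\dots\}$; this constant depends only on $\pi_1(\mathrm{Id}_X)$. Then $C>0$, and for all $\lambda>1$, $1\le p<\infty$, $1\le q\le\infty$: (i) for every $n\ge 2$, $$K^p(B_{\ell^n_q},X,\lambda)\le B\,\lambda^{2/p}\,n^{1-1/p}\Big(\frac{\log n}{n}\Big)^{1-1/\min\{q,2\}};$$ (ii) for every $n\ge 1$, with $r=\dfrac{pq'}{pq'-1}\in[1,\infty]$ the conjugate exponent of $pq'$ (so $r=1$ if $q=1$ and $r=\infty$ if $pq'=1$) and $0^0=1$, $$K^p(B_{\ell^n_q},X,\lambda)\ge C\Big(\frac{\lambda-1}{2\lambda-1}\Big)^{1/p}\Big(\frac{\log n}{n}\Big)^{1-1/r}\quad\text{if } q\le r,$$ $$K^p(B_{\ell^n_q},X,\lambda)\ge C\Big(\frac{\lambda-1}{2\lambda-1}\Big)^{1/p}n^{1/q-1/r}\Big(\frac{\log n}{n}\Big)^{1-1/r}\quad\text{if } r<q.$$ -/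

import Mathlib

open scoped ENNReal NNReal Pointwise

noncomputable section

/-- The open unit ball `B_{ℓ^n_q}` of the Banach space `ℓ^n_q = (ℂ^n, ‖·‖_q)`, `1 ≤ q ≤ ∞`. -/
def lqBall (n : ℕ) (q : ℝ≥0∞) [Fact (1 ≤ q)] : Set (PiLp q (fun _ : Fin n => ℂ)) :=
  Metric.ball 0 1

/-- The monomial `z^α = z_1^{α_1} ⋯ z_n^{α_n}`. -/
def monomialAt {n : ℕ} {q : ℝ≥0∞} (z : PiLp q (fun _ : Fin n => ℂ)) (α : Fin n → ℕ) : ℂ :=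
  ∏ i, z i ^ α i

/-- `f` is a holomorphic function on `B_{ℓ^n_q}` with values in `X`, and
`f(z) = ∑_α x_α z^α` (over all multi-indices `α ∈ ℕ₀^n`) is its monomial series expansion there. -/
def IsHolomorphicWithExpansion {X : Type*} [NormedAddCommGroup X] [NormedSpace ℂ X]
    (n : ℕ) (q : ℝ≥0∞) [Fact (1 ≤ q)]
    (f : PiLp q (fun _ : Fin n => ℂ) → X) (x : (Fin n → ℕ) → X) : Prop :=
  DifferentiableOn ℂ f (lqBall n q) ∧
    ∀ z ∈ lqBall n q, HasSum (fun α : Fin n → ℕ => monomialAt z α • x α) (f z)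

/-- The radius `r ≥ 0` is admissible for `T`: for all holomorphic `f(z) = ∑_α x_α z^α` on
`B_{ℓ^n_q}`,
`sup_{z ∈ r B} ∑_α ‖T(x_α) z^α‖^p ≤ λ sup_{z ∈ B} ‖f(z)‖^p`.
All quantities are extended nonnegative reals, so that the inequality is void for unbounded `f`. -/
def IsBohrAdmissible {X Y : Type*} [NormedAddCommGroup X] [NormedSpace ℂ X]
    [NormedAddCommGroup Y] [NormedSpace ℂ Y]
    (p : ℝ) (n : ℕ) (q : ℝ≥0∞) [Fact (1 ≤ q)] (T : X →L[ℂ] Y) (lam : ℝ) (r : ℝ≥0) : Prop :=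
  ∀ (f : PiLp q (fun _ : Fin n => ℂ) → X) (x : (Fin n → ℕ) → X),
    IsHolomorphicWithExpansion n q f x →
      (⨆ z ∈ ((r : ℝ) : ℂ) • lqBall n q, ∑' α : Fin n → ℕ, ‖monomialAt z α • T (x α)‖ₑ ^ p)
        ≤ ENNReal.ofReal lam * ⨆ z ∈ lqBall n q, ‖f z‖ₑ ^ p

/-- The `λ_p`-Bohr radius `K^p(B_{ℓ^n_q}, T, λ)`: the supremum, in `[0, ∞]`, of all admissible
`r ≥ 0`. -/
def bohrRadius {X Y : Type*} [NormedAddCommGroup X] [NormedSpace ℂ X]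
    [NormedAddCommGroup Y] [NormedSpace ℂ Y]
    (p : ℝ) (n : ℕ) (q : ℝ≥0∞) [Fact (1 ≤ q)] (T : X →L[ℂ] Y) (lam : ℝ) : ℝ≥0∞ :=
  ⨆ (r : ℝ≥0) (_ : IsBohrAdmissible p n q T lam r), (r : ℝ≥0∞)

/-- `K^p(B_{ℓ^n_q}, X, λ)`: the `λ_p`-Bohr radius of the identity of `X`. -/
def bohrRadiusSpace (p : ℝ) (n : ℕ) (q : ℝ≥0∞) [Fact (1 ≤ q)]
    (X : Type*) [NormedAddCommGroup X] [NormedSpace ℂ X] (lam : ℝ) : ℝ≥0∞ :=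
  bohrRadius p n q (ContinuousLinearMap.id ℂ X) lam

/-- The absolutely summing norm `π_1(T)`: the least `C ∈ [0, ∞]` such that
`∑_j ‖T x_j‖ ≤ C sup_{x* ∈ B_{X*}} ∑_j |x*(x_j)|` for all finite families in `X`. -/
def oneSummingNorm {X Y : Type*} [NormedAddCommGroup X] [NormedSpace ℂ X]
    [NormedAddCommGroup Y] [NormedSpace ℂ Y] (T : X →L[ℂ] Y) : ℝ≥0∞ :=
  sInf {C : ℝ≥0∞ | ∀ (k : ℕ) (x : Fin k → X),
    ∑ j, ‖T (x j)‖ₑ ≤ C * ⨆ φ ∈ Metric.ball (0 : StrongDual ℂ X) 1, ∑ j, ‖φ (x j)‖ₑ}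

/-- The constant `C = e⁻¹ inf_{m ≥ 1} π_1(Id_X)^{-1/m}`. -/
def bohrLowerConst (X : Type*) [NormedAddCommGroup X] [NormedSpace ℂ X] : ℝ≥0∞ :=
  ENNReal.ofReal (Real.exp (-1)) *
    ⨅ m : ℕ+, oneSummingNorm (ContinuousLinearMap.id ℂ X) ^ (-(1 / (m : ℝ)))

/-- The exponent `r = p q' / (p q' - 1) ∈ [1, ∞]`, that is, the conjugate exponent of `p q'`, where
`q'` is the conjugate exponent of `q` (so `r = 1` if `q = 1`, and `r = ∞` if `p q' = 1`). -/
def bohrExponent (p : ℝ) (q : ℝ≥0∞) : ℝ≥0∞ :=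
  ENNReal.conjExponent (ENNReal.ofReal p * ENNReal.conjExponent q)

/-- `1/s` as a real number, with `1/∞ = 0`. -/
def recip (s : ℝ≥0∞) : ℝ := (s⁻¹).toReal

end

/-! Lower estimates. Let `‖f‖ ≤ M` on the ball. Averaging over rotations bounds every homogeneous
part and every single term `x_α z^α` by `M`. For a scalar polynomial of degree `k+1`,
`sum_norm_coeff_le` bounds the sum of the moduli of its terms by `(e (n / log n)^{1-1/q})^{k+1} M`.
The coefficients of the directional derivative, a polynomial of degree `k`, are estimated at the
points where the monomials peak, and Hölder's inequality then leaves a power of the number of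
monomials of degree `k` rather than `k+1`. This lost degree is what produces the logarithm. Passing
to `X` costs one factor `π_1(Id_X)` per degree. Interpolating the `ℓ_1` bound with the bound on
single terms turns it into an `ℓ_p` bound, so a radius whose `p`-th power is of order `t (log n /
n)^{1-1/q}` makes degree `m` contribute at most `t^m M^p`. For `t = (λ-1)/(2λ-1)` the geometric
series sums to at most `λ M^p`. The exponents fit because `1 - 1/r = (1-1/q)/p`; hence `1/q ≤ 1/r`,
so `n^{1/q-1/r} ≤ 1` and one estimate covers both cases.

Upper estimate. The test functions are `∑ ε_α (m!/α!) z^α e`, over `|α| = m = ⌈log n⌉`, with `‖e‖ =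
1`. Signs chosen by exponential moments over a finite grid (`exists_signs_polynomial_norm_le`) keep
the supremum on `B_{ℓ_σ}`, `σ = min(q, 2)`, below `n^7 (m!)^{1-1/σ}`. On the diagonal all terms have
full size, with total coefficient `n^m`. Taking `m`-th roots gives the bound, the factor `n^7`
costing only `e^7`; comparing `ℓ_p` with `ℓ_1` sums costs `n^{1-1/p}`. -/

/-! ### Fourier averaging over circles and tori -/

theorem integral_exp_int_mul_I (k : ℤ) :
    ∫ θ in (0 : ℝ)..2 * Real.pi, Complex.exp ((k : ℂ) * Complex.I * θ) =
      if k = 0 then 2 * Real.pi else 0 := by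
  split_ifs with hk
  · simp [hk]
  · have hc : (k : ℂ) * Complex.I ≠ 0 := mul_ne_zero (by exact_mod_cast hk) Complex.I_ne_zero
    rw [integral_exp_mul_complex hc]
    have : (k : ℂ) * Complex.I * ((2 * Real.pi : ℝ) : ℂ) = k * (2 * Real.pi * Complex.I) := by
      push_cast; ring
    rw [this, Complex.exp_int_mul_two_pi_mul_I]
    simp

/-- The part of weight `m` of an absolutely convergent series is bounded by the supremum of the
corresponding power series over the unit circle. -/
theorem norm_tsum_ite_le_of_circle_bound {ι X : Type*} [Countable ι] [NormedAddCommGroup X]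
    [NormedSpace ℂ X] [CompleteSpace X] {a : ι → X} (ha : Summable fun i => ‖a i‖) (e : ι → ℕ)
    {M : ℝ} (h : ∀ ζ : ℂ, ‖ζ‖ = 1 → ‖∑' i, ζ ^ e i • a i‖ ≤ M) (m : ℕ) :
    ‖∑' i, if e i = m then a i else 0‖ ≤ M := by
  -- The Fourier coefficient of index `m` is integrated termwise, with `‖a i‖` as dominating
  -- sequence; only the terms of weight `m` survive.
  set F : ι → ℝ → X := fun i θ => Complex.exp ((((e i : ℤ) - m : ℤ) : ℂ) * Complex.I * θ) • a i
    with hF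
  have hnormF : ∀ i θ, ‖F i θ‖ = ‖a i‖ := by
    intro i θ
    rw [hF]
    simp only [norm_smul]
    rw [show (((e i : ℤ) - m : ℤ) : ℂ) * Complex.I * θ =
      (((((e i : ℤ) - m : ℤ) : ℝ) * θ : ℝ) : ℂ) * Complex.I by push_cast; ring,
      Complex.norm_exp_ofReal_mul_I, one_mul]
  have hsumF : ∀ θ, Summable fun i => F i θ := fun θ =>
    Summable.of_norm (by simpa only [hnormF] using ha)
  have hcont : ∀ i, Continuous (F i) := by intro i; rw [hF]; fun_prop
  have hfact : ∀ θ : ℝ, ‖∑' i, F i θ‖ ≤ M := by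
    intro θ
    have hz : ‖Complex.exp (θ * Complex.I)‖ = 1 := Complex.norm_exp_ofReal_mul_I θ
    have hF' : ∀ i, F i θ = Complex.exp (-(m : ℂ) * θ * Complex.I) •
        (Complex.exp (θ * Complex.I) ^ e i • a i) := by
      intro i
      rw [smul_smul, ← Complex.exp_nat_mul, ← Complex.exp_add]
      simp only [hF]
      congr 2
      push_cast
      ring
    have hs : Summable fun i => Complex.exp (θ * Complex.I) ^ e i • a i :=
      Summable.of_norm (by simpa [norm_smul, hz] using ha)
    rw [tsum_congr hF', hs.tsum_const_smul, norm_smul]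
    rw [show -(m : ℂ) * θ * Complex.I = ((-(m : ℝ) * θ : ℝ) : ℂ) * Complex.I by push_cast; ring,
      Complex.norm_exp_ofReal_mul_I, one_mul]
    exact h _ hz
  have key := intervalIntegral.hasSum_integral_of_dominated_convergence
    (a := 0) (b := 2 * Real.pi) (F := F) (f := fun θ => ∑' i, F i θ)
    (μ := MeasureTheory.volume) (fun i _ => ‖a i‖)
    (fun i => (hcont i).aestronglyMeasurable) (fun i => by simp [hnormF])
    (by simp [ha]) (by simp) (by simpa using Filter.Eventually.of_forall fun θ _ => (hsumF θ).hasSum)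
  have hint : ∀ i, ∫ θ in (0 : ℝ)..2 * Real.pi, F i θ =
      (2 * Real.pi : ℂ) • (if e i = m then a i else 0) := by
    intro i
    rw [hF]
    simp only
    rw [intervalIntegral.integral_smul_const, integral_exp_int_mul_I]
    by_cases hi : e i = m
    · simp [hi]
    · have : ¬ ((e i : ℤ) - m = 0) := by omega
      simp [hi, this]
  simp only [hint] at key
  have hpi : (2 * Real.pi : ℂ) ≠ 0 := by simp [Real.pi_ne_zero]
  have hsum : Summable fun i => if e i = m then a i else 0 :=
    Summable.of_norm (ha.of_nonneg_of_le (fun _ => norm_nonneg _) fun i => by split_ifs <;> simp)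
  have heq := key.tsum_eq
  rw [hsum.tsum_const_smul] at heq
  have hb := intervalIntegral.norm_integral_le_of_norm_le_const (a := 0) (b := 2 * Real.pi)
    (f := fun θ => ∑' i, F i θ) (C := M) (fun θ _ => hfact θ)
  have h2 : (0 : ℝ) < 2 * Real.pi := by positivity
  rw [← heq, norm_smul, sub_zero, abs_of_pos h2] at hb
  have h3 : ‖(2 * Real.pi : ℂ)‖ = 2 * Real.pi := by
    rw [show (2 * Real.pi : ℂ) = ((2 * Real.pi : ℝ) : ℂ) by push_cast; ring, Complex.norm_real,
      Real.norm_of_nonneg h2.le]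
  rw [h3, mul_comm M] at hb
  exact le_of_mul_le_mul_left hb h2

/-- Each coefficient of an absolutely convergent multi-index series is bounded by the supremum of
the series over the torus. -/
theorem norm_coeff_le_of_torus_bound {n : ℕ} {X : Type*} [NormedAddCommGroup X]
    [NormedSpace ℂ X] [CompleteSpace X] {a : (Fin n → ℕ) → X} (ha : Summable fun α => ‖a α‖)
    {M : ℝ} (h : ∀ θ : Fin n → ℂ, (∀ i, ‖θ i‖ = 1) → ‖∑' α, (∏ i, θ i ^ α i) • a α‖ ≤ M)
    (β : Fin n → ℕ) : ‖a β‖ ≤ M := by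
  -- Induction on the set `T` of coordinates whose exponent is already prescribed. The family
  -- varies, because fixing the exponent in coordinate `j` replaces it by a truncation, whose torus
  -- bound comes from rotating that coordinate alone.
  have main : ∀ T : Finset (Fin n), ∀ a : (Fin n → ℕ) → X, (Summable fun α => ‖a α‖) →
      (∀ θ : Fin n → ℂ, (∀ i, ‖θ i‖ = 1) → ‖∑' α, (∏ i, θ i ^ α i) • a α‖ ≤ M) →
      ‖∑' α, if ∀ i ∈ T, α i = β i then a α else 0‖ ≤ M := by
    intro T
    induction T using Finset.induction_on with
    | empty => intro a _ h; simpa using h (fun _ => 1) (by simp)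
    | insert j T hj ih =>
      intro a ha h
      have ha' : Summable fun α => ‖if α j = β j then a α else 0‖ :=
        ha.of_nonneg_of_le (fun _ => norm_nonneg _) fun i => by split_ifs <;> simp
      have := ih (fun α => if α j = β j then a α else 0) ha' ?_
      · convert this using 4 with α
        by_cases h1 : α j = β j <;> simp [h1]
      · intro θ hθ
        have hn : ∀ α : Fin n → ℕ, ‖∏ i, θ i ^ α i‖ = 1 := by intro α; simp [norm_prod, hθ]
        have := norm_tsum_ite_le_of_circle_bound (a := fun α => (∏ i, θ i ^ α i) • a α)
          (by simpa [norm_smul, hn] using ha) (fun α => α j) (M := M) ?_ (β j)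
        · convert this using 4 with α
          by_cases h1 : α j = β j <;> simp [h1]
        · intro ζ hζ
          have := h (fun i => if i = j then ζ * θ i else θ i) (by
            intro i; by_cases hi : i = j <;> simp [hi, hζ, hθ])
          convert this using 4 with α
          rw [smul_smul]
          congr 1
          have : ∀ i, (if i = j then ζ * θ i else θ i) ^ α i =
              (if i = j then ζ ^ α i else 1) * θ i ^ α i := by
            intro i; by_cases hi : i = j <;> simp [hi, mul_pow]
          simp_rw [this, Finset.prod_mul_distrib, Finset.prod_ite_eq' Finset.univ j,
            Finset.mem_univ, if_true]
  have := main Finset.univ a ha h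
  have h2 : ∀ α : Fin n → ℕ, (∀ i ∈ Finset.univ, α i = β i) ↔ α = β := by
    intro α; simp [funext_iff]
  simp only [h2] at this
  rwa [tsum_ite_eq] at this

/-! ### The norm of `ℓ_q^n` -/

theorem recip_nonneg (q : ℝ≥0∞) : 0 ≤ recip q := ENNReal.toReal_nonneg

theorem recip_le_one {q : ℝ≥0∞} (hq : 1 ≤ q) : recip q ≤ 1 := by
  rw [recip]
  exact ENNReal.toReal_le_of_le_ofReal zero_le_one (by simpa using hq)

theorem recip_eq_inv_toReal (q : ℝ≥0∞) : recip q = q.toReal⁻¹ := ENNReal.toReal_inv q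

theorem one_le_toReal_of_ne_top {q : ℝ≥0∞} (hq : 1 ≤ q) (hq' : q ≠ ∞) : 1 ≤ q.toReal := by
  simpa using ENNReal.toReal_mono hq' hq

theorem lq_norm_le_one_iff {n : ℕ} {q : ℝ≥0∞} [hq : Fact (1 ≤ q)] (hq' : q ≠ ∞)
    (w : PiLp q (fun _ : Fin n => ℂ)) : ‖w‖ ≤ 1 ↔ ∑ i, ‖w i‖ ^ q.toReal ≤ 1 := by
  have h1 := one_le_toReal_of_ne_top hq.out hq'
  rw [PiLp.norm_eq_sum (by linarith)]
  have h0 : 0 ≤ ∑ i, ‖w i‖ ^ q.toReal := by positivity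
  have h2 : 0 < 1 / q.toReal := by positivity
  refine ⟨fun h => ?_, fun h => Real.rpow_le_one h0 h h2.le⟩
  by_contra h3
  exact absurd h (not_le.2 (Real.one_lt_rpow (not_le.1 h3) h2))

theorem linfty_norm_le_one_iff {n : ℕ} (w : PiLp ∞ (fun _ : Fin n => ℂ)) :
    ‖w‖ ≤ 1 ↔ ∀ i, ‖w i‖ ≤ 1 := by
  rw [PiLp.norm_eq_ciSup]
  constructor
  · intro h i
    exact (le_ciSup (f := fun i => ‖w i‖) (Set.finite_range _).bddAbove i).trans h
  · intro h
    exact Real.iSup_le h zero_le_one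

theorem lq_norm_mono {n : ℕ} {q : ℝ≥0∞} [hq : Fact (1 ≤ q)]
    {u w : PiLp q (fun _ : Fin n => ℂ)} (h : ∀ i, ‖u i‖ ≤ ‖w i‖) : ‖u‖ ≤ ‖w‖ := by
  rcases eq_or_ne q ∞ with rfl | hq'
  · rw [PiLp.norm_eq_ciSup, PiLp.norm_eq_ciSup]
    exact Real.iSup_le (fun i => (h i).trans
      (le_ciSup (f := fun i => ‖w i‖) (Set.finite_range _).bddAbove i))
      (Real.iSup_nonneg fun i => norm_nonneg _)
  · have h1 := one_le_toReal_of_ne_top hq.out hq'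
    rw [PiLp.norm_eq_sum (by linarith), PiLp.norm_eq_sum (by linarith)]
    gcongr with i
    exact h i

/-- The maximiser of `|u^β|` on the unit sphere of `ℓ_q^n`. -/
theorem lq_norm_rpow_recip_le_one {n : ℕ} {q : ℝ≥0∞} [hq : Fact (1 ≤ q)] {t : Fin n → ℝ}
    (ht : ∀ i, 0 ≤ t i) (hsum : ∑ i, t i ≤ 1) :
    ‖(WithLp.toLp q (fun i => ((t i ^ recip q : ℝ) : ℂ)) : PiLp q (fun _ : Fin n => ℂ))‖ ≤ 1 := by
  rcases eq_or_ne q ∞ with rfl | hq'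
  · rw [linfty_norm_le_one_iff]
    intro i
    simp [recip]
  · rw [lq_norm_le_one_iff hq']
    have h1 := one_le_toReal_of_ne_top hq.out hq'
    refine le_trans (le_of_eq (Finset.sum_congr rfl fun i _ => ?_)) hsum
    have h0 : 0 ≤ t i ^ recip q := Real.rpow_nonneg (ht i) _
    simp only [Complex.norm_real, Real.norm_of_nonneg h0]
    rw [← Real.rpow_mul (ht i), recip_eq_inv_toReal, inv_mul_cancel₀ (by linarith), Real.rpow_one]

/-! ### Coefficient sums of homogeneous polynomials -/

/-- The multi-index `e_i`. -/
def unitIndex {n : ℕ} (i : Fin n) : Fin n → ℕ := Pi.single i 1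

@[simp] theorem unitIndex_self {n : ℕ} (i : Fin n) : unitIndex i i = 1 := by simp [unitIndex]

theorem unitIndex_of_ne {n : ℕ} {i j : Fin n} (h : j ≠ i) : unitIndex i j = 0 := by
  simp [unitIndex, h]

@[simp] theorem sum_unitIndex {n : ℕ} (i : Fin n) : ∑ j, unitIndex i j = 1 := by simp [unitIndex]

/-- Reindexing by `α = β + e_i`; the indices with `α i = 0` are missed, but their weight vanishes.
It serves both to differentiate monomials and for Euler's identity. -/
theorem sum_piAntidiag_succ {n : ℕ} {R : Type*} [CommSemiring R] (k : ℕ) (i : Fin n)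
    (g : (Fin n → ℕ) → R) :
    ∑ α ∈ Finset.univ.piAntidiag (k + 1), (α i : R) * g α =
      ∑ β ∈ Finset.univ.piAntidiag k, ((β i : R) + 1) * g (β + unitIndex i) := by
  symm
  refine Finset.sum_of_injOn (fun β => β + unitIndex i)
    (fun _ _ _ _ h => add_right_cancel h) ?_ ?_ ?_
  · intro β hβ
    simp only [Finset.mem_coe, Finset.mem_piAntidiag, Finset.mem_univ, implies_true, and_true]
      at hβ ⊢
    simp [Finset.sum_add_distrib, hβ]
  · intro α hα hnot
    simp only [Finset.mem_piAntidiag, Finset.mem_univ, implies_true, and_true] at hα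
    have : α i = 0 := by
      by_contra h0
      apply hnot
      have hle : unitIndex i ≤ α := by
        intro j
        by_cases hj : j = i
        · subst hj; simp; omega
        · simp [unitIndex_of_ne hj]
      refine ⟨α - unitIndex i, ?_, tsub_add_cancel_of_le hle⟩
      simp only [Finset.mem_coe, Finset.mem_piAntidiag, Finset.mem_univ, implies_true, and_true]
      have h2 : ∑ j, (α - unitIndex i + unitIndex i : Fin n → ℕ) j = k + 1 := by
        rw [tsub_add_cancel_of_le hle]; exact hα
      simp only [Pi.add_apply, Finset.sum_add_distrib, sum_unitIndex] at h2
      exact Nat.add_right_cancel h2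
    simp [this]
  · intro β _
    simp

theorem prod_pow_add_single {n : ℕ} {R : Type*} [CommSemiring R] (u : Fin n → R) (β : Fin n → ℕ)
    (i : Fin n) : ∏ j, u j ^ (β + unitIndex i : Fin n → ℕ) j = (∏ j, u j ^ β j) * u i := by
  simp only [Pi.add_apply, pow_add, Finset.prod_mul_distrib]
  congr 1
  rw [Finset.prod_eq_single i] <;> simp +contextual [unitIndex_of_ne]

theorem hasDerivAt_monomial_line {n : ℕ} (u v : Fin n → ℂ) (α : Fin n → ℕ) :
    HasDerivAt (fun ζ : ℂ => ∏ i, (u i + ζ * v i) ^ α i)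
      (∑ i, (α i : ℂ) * (∏ j, u j ^ (α - unitIndex i : Fin n → ℕ) j) * v i) 0 := by
  have h : ∀ i ∈ Finset.univ, HasDerivAt (fun ζ : ℂ => (u i + ζ * v i) ^ α i)
      ((α i : ℂ) * (u i + 0 * v i) ^ (α i - 1) * v i) 0 := by
    intro i _
    have h1 : HasDerivAt (fun ζ : ℂ => u i + ζ * v i) (v i) 0 := by
      simpa using ((hasDerivAt_id (0 : ℂ)).mul_const (v i)).const_add (u i)
    exact h1.pow (α i)
  refine (HasDerivAt.fun_finsetProd h).congr_deriv (Finset.sum_congr rfl fun i _ => ?_)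
  symm
  rw [← Finset.mul_prod_erase Finset.univ
    (fun j => u j ^ (α - unitIndex i : Fin n → ℕ) j) (Finset.mem_univ i)]
  have : ∏ j ∈ Finset.univ.erase i, u j ^ (α - unitIndex i : Fin n → ℕ) j =
      ∏ j ∈ Finset.univ.erase i, (u j + 0 * v j) ^ α j := by
    refine Finset.prod_congr rfl fun j hj => ?_
    simp [unitIndex_of_ne (Finset.ne_of_mem_erase hj)]
  rw [this]
  simp
  ring

/-- Cauchy estimate for the derivative of an `(k+1)`-homogeneous polynomial. -/
theorem norm_deriv_homogeneous_le {n k : ℕ} {q : ℝ≥0∞} [Fact (1 ≤ q)] {c : (Fin n → ℕ) → ℂ}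
    {M : ℝ} (hM : 0 ≤ M)
    (hP : ∀ u : PiLp q (fun _ : Fin n => ℂ),
      ‖∑ α ∈ Finset.univ.piAntidiag (k + 1), c α * ∏ i, u i ^ α i‖ ≤ M * ‖u‖ ^ (k + 1))
    {u v : PiLp q (fun _ : Fin n => ℂ)} (hu : ‖u‖ ≤ 1) (hv : ‖v‖ ≤ 1) :
    ‖∑ β ∈ Finset.univ.piAntidiag k,
      (∑ i, ((β i : ℂ) + 1) * c (β + unitIndex i) * v i) * ∏ j, u j ^ β j‖
        ≤ (k + 1) * (Real.exp 1 * M) := by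
  set g : ℂ → ℂ := fun ζ => ∑ α ∈ Finset.univ.piAntidiag (k + 1), c α * ∏ i, (u i + ζ * v i) ^ α i
    with hg
  have hder : HasDerivAt g (∑ β ∈ Finset.univ.piAntidiag k,
      (∑ i, ((β i : ℂ) + 1) * c (β + unitIndex i) * v i) * ∏ j, u j ^ β j) 0 := by
    have h1 := HasDerivAt.fun_sum (u := Finset.univ.piAntidiag (k + 1))
      (fun α _ => (hasDerivAt_monomial_line (fun i => u i) (fun i => v i) α).const_mul (c α))
    refine h1.congr_deriv ?_
    symm
    simp only [Finset.sum_mul, Finset.mul_sum]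
    rw [Finset.sum_comm, Finset.sum_comm (s := Finset.univ.piAntidiag (k + 1))]
    refine Finset.sum_congr rfl fun i _ => ?_
    have := sum_piAntidiag_succ k i
      (fun α => c α * (∏ j, u j ^ (α - unitIndex i : Fin n → ℕ) j) * v i)
    have hcancel : ∀ β : Fin n → ℕ, (β + unitIndex i - unitIndex i : Fin n → ℕ) = β := by
      intro β; ext j; simp
    simp only [hcancel] at this
    calc _ = _ := Finset.sum_congr rfl fun β _ => by ring
      _ = _ := this.symm
      _ = _ := Finset.sum_congr rfl fun β _ => by ring
  rw [← hder.deriv]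
  have hk : (0 : ℝ) < k + 1 := by positivity
  -- On the circle of radius `1/(k+1)` the norm of `u + ζ v` grows by at most `1 + 1/(k+1)`, whose
  -- power `k+1` stays below `e`.
  have hR : (0 : ℝ) < 1 / (k + 1) := by positivity
  have hbound : ∀ ζ ∈ Metric.sphere (0 : ℂ) (1 / (k + 1)), ‖g ζ‖ ≤ Real.exp 1 * M := by
    intro ζ hζ
    have hζ' : ‖ζ‖ = 1 / (k + 1) := by simpa using hζ
    have h1 := hP (u + ζ • v)
    have h2 : ‖u + ζ • v‖ ≤ 1 + 1 / (k + 1) := by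
      calc _ ≤ ‖u‖ + ‖ζ • v‖ := norm_add_le _ _
        _ ≤ 1 + 1 / (k + 1) * 1 := by rw [norm_smul, hζ']; gcongr
        _ = _ := by ring
    have h3 : (1 + 1 / ((k : ℝ) + 1)) ^ (k + 1) ≤ Real.exp 1 := by
      calc _ ≤ (Real.exp (1 / ((k : ℝ) + 1))) ^ (k + 1) := by
            gcongr
            linarith [Real.add_one_le_exp (1 / ((k : ℝ) + 1))]
        _ = _ := by
            rw [← Real.exp_nat_mul]
            congr 1
            push_cast
            field_simp
    calc ‖g ζ‖ ≤ M * ‖u + ζ • v‖ ^ (k + 1) := by simpa [hg] using h1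
      _ ≤ M * (1 + 1 / ((k : ℝ) + 1)) ^ (k + 1) := by gcongr
      _ ≤ M * Real.exp 1 := by gcongr
      _ = _ := mul_comm _ _
  have hd : Differentiable ℂ g := by rw [hg]; fun_prop
  refine (Complex.norm_deriv_le_of_forall_mem_sphere_norm_le hR hd.diffContOnCl hbound).trans
    (le_of_eq ?_)
  field_simp

theorem norm_coeff_mul_le_of_torus_bound {n : ℕ} (s : Finset (Fin n → ℕ)) (b : (Fin n → ℕ) → ℂ)
    (u : Fin n → ℂ) {M : ℝ}
    (h : ∀ u' : Fin n → ℂ, (∀ i, ‖u' i‖ = ‖u i‖) → ‖∑ β ∈ s, b β * ∏ i, u' i ^ β i‖ ≤ M)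
    {β : Fin n → ℕ} (hβ : β ∈ s) : ‖b β‖ * ∏ i, ‖u i‖ ^ β i ≤ M := by
  have := norm_coeff_le_of_torus_bound
    (a := fun β => if β ∈ s then b β * ∏ i, u i ^ β i else 0) (M := M)
    (summable_of_ne_finset_zero (s := s) (by intro b hb; simp [hb])) ?_ β
  · simpa [hβ, norm_prod] using this
  · intro θ hθ
    rw [tsum_eq_sum (s := s) (by intro b hb; simp [hb])]
    refine le_of_eq_of_le ?_ (h (fun i => θ i * u i) (by simp [hθ]))
    congr 1
    refine Finset.sum_congr rfl fun β hβ => ?_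
    simp only [hβ, if_true, mul_pow, Finset.prod_mul_distrib, smul_eq_mul]
    ring

/-- From `k^k ≤ e^k k!` and `∏ β_i! ≤ ∏ β_i^{β_i}`. For `k = 0` both sides are covered by `0^0 = 1`.
-/
theorem inv_prod_pow_le_exp_mul_multinomial {n k : ℕ} {β : Fin n → ℕ}
    (hβ : β ∈ Finset.univ.piAntidiag k) :
    1 ≤ (Real.exp k * Nat.multinomial Finset.univ β) * ∏ i, ((β i : ℝ) / k) ^ β i := by
  simp only [Finset.mem_piAntidiag, Finset.mem_univ, implies_true, and_true] at hβ
  have hspec := Nat.multinomial_spec Finset.univ β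
  rw [hβ] at hspec
  have hspec' : (∏ i, ((β i).factorial : ℝ)) * Nat.multinomial Finset.univ β = k.factorial := by
    exact_mod_cast hspec
  have hprod : ∏ i, ((β i : ℝ) / k) ^ β i = (∏ i, (β i : ℝ) ^ β i) / (k : ℝ) ^ k := by
    simp only [div_pow, Finset.prod_div_distrib, Finset.prod_pow_eq_pow_sum, hβ]
  have hkk : (0 : ℝ) < (k : ℝ) ^ k := by
    rcases Nat.eq_zero_or_pos k with rfl | h
    · simp
    · positivity
  have h1 : ∏ i, ((β i).factorial : ℝ) ≤ ∏ i, (β i : ℝ) ^ β i := by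
    gcongr with i
    exact_mod_cast Nat.factorial_le_pow (β i)
  have h2 : (k : ℝ) ^ k ≤ Real.exp k * k.factorial := by
    have := Real.pow_div_factorial_le_exp (x := (k : ℝ)) (by positivity) k
    rwa [div_le_iff₀ (by positivity)] at this
  rw [hprod, mul_div_assoc', le_div_iff₀ hkk, one_mul]
  calc (k : ℝ) ^ k ≤ Real.exp k * k.factorial := h2
    _ = Real.exp k * Nat.multinomial Finset.univ β * ∏ i, ((β i).factorial : ℝ) := by
        rw [← hspec']; ring
    _ ≤ _ := by gcongr

/-- Hölder's inequality combined with the multinomial theorem. -/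
theorem sum_multinomial_rpow_mul_le {n : ℕ} {q : ℝ≥0∞} [hq : Fact (1 ≤ q)]
    {w : PiLp q (fun _ : Fin n => ℂ)} (hw : ‖w‖ ≤ 1) (k : ℕ) :
    ∑ β ∈ Finset.univ.piAntidiag k,
        (Real.exp k * Nat.multinomial Finset.univ β) ^ recip q * ∏ i, ‖w i‖ ^ β i
      ≤ Real.exp (k * recip q) *
        ((Finset.univ.piAntidiag k : Finset (Fin n → ℕ)).card : ℝ) ^ (1 - recip q) := by
  rcases eq_or_ne q ∞ with rfl | hq'
  · rw [linfty_norm_le_one_iff] at hw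
    simp only [recip, ENNReal.inv_top, ENNReal.toReal_zero, Real.rpow_zero, one_mul, mul_zero,
      Real.exp_zero, sub_zero, Real.rpow_one]
    calc _ ≤ ∑ β ∈ (Finset.univ.piAntidiag k : Finset (Fin n → ℕ)), (1 : ℝ) := by
          gcongr with β
          exact Finset.prod_le_one (fun _ _ => by positivity)
            fun i _ => pow_le_one₀ (norm_nonneg _) (hw i)
      _ = _ := by simp
  · have h1 := one_le_toReal_of_ne_top hq.out hq'
    have h0 : 0 < q.toReal := by linarith
    rw [lq_norm_le_one_iff hq'] at hw
    set N : ℝ := ((Finset.univ.piAntidiag k : Finset (Fin n → ℕ)).card : ℝ) with hN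
    set a : (Fin n → ℕ) → ℝ := fun β =>
      (Real.exp k * Nat.multinomial Finset.univ β) ^ recip q * ∏ i, ‖w i‖ ^ β i with ha
    have ha0 : ∀ β, 0 ≤ a β := fun β => by rw [ha]; positivity
    have hH := Real.rpow_sum_le_const_mul_sum_rpow (Finset.univ.piAntidiag k) a h1
    simp only [abs_of_nonneg (ha0 _)] at hH
    have hq1 : recip q * q.toReal = 1 := by
      rw [recip_eq_inv_toReal, inv_mul_cancel₀ h0.ne']
    -- The exponent `1/q` on the multinomial coefficient is chosen so that the `q`-th powers form a
    -- multinomial expansion of `(∑ |w_i|^q)^k ≤ 1`.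
    have hsum : ∑ β ∈ Finset.univ.piAntidiag k, a β ^ q.toReal ≤ Real.exp k := by
      have : ∀ β, a β ^ q.toReal =
          Real.exp k * (Nat.multinomial Finset.univ β * ∏ i, (‖w i‖ ^ q.toReal) ^ β i) := by
        intro β
        rw [ha]
        simp only
        rw [Real.mul_rpow (by positivity) (by positivity), ← Real.rpow_mul (by positivity), hq1,
          Real.rpow_one, ← Real.finsetProd_rpow _ _ (fun i _ => by positivity), mul_assoc]
        congr 2
        refine Finset.prod_congr rfl fun i _ => ?_
        rw [← Real.rpow_natCast, ← Real.rpow_natCast, ← Real.rpow_mul (norm_nonneg _),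
          ← Real.rpow_mul (norm_nonneg _), mul_comm]
      simp only [this, ← Finset.mul_sum]
      rw [← Finset.sum_pow_eq_sum_piAntidiag]
      have : (∑ i, ‖w i‖ ^ q.toReal) ^ k ≤ 1 := pow_le_one₀ (by positivity) hw
      nlinarith [Real.exp_pos k]
    have hfin : (∑ β ∈ Finset.univ.piAntidiag k, a β) ^ q.toReal ≤
        N ^ (q.toReal - 1) * Real.exp k := hH.trans (by gcongr)
    have hS : 0 ≤ ∑ β ∈ Finset.univ.piAntidiag k, a β := Finset.sum_nonneg fun β _ => ha0 β
    calc ∑ β ∈ Finset.univ.piAntidiag k, a β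
        = ((∑ β ∈ Finset.univ.piAntidiag k, a β) ^ q.toReal) ^ recip q := by
          rw [← Real.rpow_mul hS, mul_comm, hq1, Real.rpow_one]
      _ ≤ (N ^ (q.toReal - 1) * Real.exp k) ^ recip q := by
          gcongr
          exact recip_nonneg q
      _ = _ := by
          rw [Real.mul_rpow (by positivity) (by positivity), ← Real.rpow_mul (by positivity),
            ← Real.exp_mul, mul_comm]
          congr 2
          linear_combination hq1

theorem exists_norm_one_mul_eq_norm (z : ℂ) : ∃ θ : ℂ, ‖θ‖ = 1 ∧ θ * z = ‖z‖ := by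
  rcases eq_or_ne z 0 with rfl | hz
  · exact ⟨1, by simp⟩
  · have h : (‖z‖ : ℂ) ≠ 0 := by simpa using hz
    refine ⟨‖z‖ / z, by simp [hz], by field_simp⟩

/-- The coefficient sum of an `(k+1)`-homogeneous polynomial in terms of its supremum norm. -/
theorem sum_norm_coeff_le_card {n k : ℕ} {q : ℝ≥0∞} [Fact (1 ≤ q)] {c : (Fin n → ℕ) → ℂ}
    {M : ℝ} (hM : 0 ≤ M)
    (hP : ∀ u : PiLp q (fun _ : Fin n => ℂ),
      ‖∑ α ∈ Finset.univ.piAntidiag (k + 1), c α * ∏ i, u i ^ α i‖ ≤ M * ‖u‖ ^ (k + 1))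
    {w : PiLp q (fun _ : Fin n => ℂ)} (hw : ‖w‖ ≤ 1) :
    ∑ α ∈ Finset.univ.piAntidiag (k + 1), ‖c α‖ * ∏ i, ‖w i‖ ^ α i ≤
      Real.exp 1 * M * (Real.exp (k * recip q) *
        ((Finset.univ.piAntidiag k : Finset (Fin n → ℕ)).card : ℝ) ^ (1 - recip q)) := by
  set D : (Fin n → ℕ) → ℝ := fun β => ∑ i, ((β i : ℝ) + 1) * ‖c (β + unitIndex i)‖ * ‖w i‖ with hD
  have hD0 : ∀ β, 0 ≤ D β := fun β => by rw [hD]; positivity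
  have hcoef : ∀ β ∈ Finset.univ.piAntidiag k, D β ≤ (k + 1) * (Real.exp 1 * M) *
      (Real.exp k * Nat.multinomial Finset.univ β) ^ recip q := by
    intro β hβ
    -- The direction `v` is `w` with phases adapted to `β`, so that the terms of the derivative's
    -- coefficient at `β` add up without cancellation to `D β`.
    choose θ hθ1 hθ2 using fun i => exists_norm_one_mul_eq_norm
      (((β i : ℂ) + 1) * c (β + unitIndex i) * w i)
    set v : PiLp q (fun _ : Fin n => ℂ) := WithLp.toLp q (fun i => θ i * w i) with hv
    have hv1 : ‖v‖ ≤ 1 := (lq_norm_mono (by intro i; simp [hv, hθ1])).trans hw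
    have hβsum : ∑ i, β i = k := by simpa using hβ
    -- The monomial `u^β` is largest on the unit ball at this point.
    set u : PiLp q (fun _ : Fin n => ℂ) :=
      WithLp.toLp q (fun i => ((((β i : ℝ) / k) ^ recip q : ℝ) : ℂ)) with hu
    have hu1 : ‖u‖ ≤ 1 := by
      refine lq_norm_rpow_recip_le_one (fun i => by positivity) ?_
      rw [← Finset.sum_div, ← Nat.cast_sum, hβsum]
      exact div_self_le_one _
    have h1 := norm_coeff_mul_le_of_torus_bound (Finset.univ.piAntidiag k)
      (fun β => ∑ i, ((β i : ℂ) + 1) * c (β + unitIndex i) * v i) (fun i => u i)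
      (M := (k + 1) * (Real.exp 1 * M)) (fun u' hu' => by
        have hu'1 : ‖(WithLp.toLp q u' : PiLp q (fun _ : Fin n => ℂ))‖ ≤ 1 :=
          (lq_norm_mono (by intro i; simp [hu'])).trans hu1
        exact norm_deriv_homogeneous_le hM hP hu'1 hv1) hβ
    have h2 : ‖∑ i, ((β i : ℂ) + 1) * c (β + unitIndex i) * v i‖ = D β := by
      have : ∀ i, ((β i : ℂ) + 1) * c (β + unitIndex i) * v i =
          ((((β i : ℝ) + 1) * ‖c (β + unitIndex i)‖ * ‖w i‖ : ℝ) : ℂ) := by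
        intro i
        have h3 := hθ2 i
        have h4 : ‖((β i : ℂ) + 1)‖ = (β i : ℝ) + 1 := by
          rw [show ((β i : ℂ) + 1) = (((β i : ℝ) + 1 : ℝ) : ℂ) by push_cast; rfl,
            Complex.norm_real, Real.norm_of_nonneg (by positivity)]
        rw [norm_mul, norm_mul, h4] at h3
        rw [← h3, hv]
        simp only
        ring
      simp only [this, ← Complex.ofReal_sum, Complex.norm_real]
      exact Real.norm_of_nonneg (hD0 β)
    rw [h2] at h1
    set W : ℝ := ∏ i, ((β i : ℝ) / k) ^ β i with hW
    have hW0 : 0 ≤ W := by rw [hW]; positivity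
    have h3 : ∏ i, ‖u i‖ ^ β i = W ^ recip q := by
      rw [hW, ← Real.finsetProd_rpow _ _ (fun i _ => by positivity)]
      refine Finset.prod_congr rfl fun i _ => ?_
      simp only [hu, Complex.norm_real]
      rw [Real.norm_of_nonneg (by positivity), ← Real.rpow_natCast, ← Real.rpow_natCast,
        ← Real.rpow_mul (by positivity), ← Real.rpow_mul (by positivity), mul_comm]
    rw [h3] at h1
    have h4 : 1 ≤ (Real.exp k * Nat.multinomial Finset.univ β) ^ recip q * W ^ recip q := by
      rw [← Real.mul_rpow (by positivity) hW0]
      exact Real.one_le_rpow (inv_prod_pow_le_exp_mul_multinomial hβ) (recip_nonneg q)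
    set Y := (Real.exp k * Nat.multinomial Finset.univ β) ^ recip q with hY
    have hY0 : 0 ≤ Y := by rw [hY]; positivity
    calc D β ≤ D β * (Y * W ^ recip q) := le_mul_of_one_le_right (hD0 β) h4
      _ = D β * W ^ recip q * Y := by ring
      _ ≤ _ := by gcongr
  -- Euler's identity: weighting each `α` by `∑ α_i = k+1` and removing one variable turns the sum
  -- over degree `k+1` into a sum over degree `k`.
  have hsum : ((k : ℝ) + 1) * ∑ α ∈ Finset.univ.piAntidiag (k + 1), ‖c α‖ * ∏ i, ‖w i‖ ^ α i =
      ∑ β ∈ Finset.univ.piAntidiag k, D β * ∏ i, ‖w i‖ ^ β i := by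
    have h1 : ∀ α ∈ (Finset.univ.piAntidiag (k + 1) : Finset (Fin n → ℕ)),
        ((k : ℝ) + 1) * (‖c α‖ * ∏ i, ‖w i‖ ^ α i) =
          ∑ i, (α i : ℝ) * (‖c α‖ * ∏ i, ‖w i‖ ^ α i) := by
      intro α hα
      have : ∑ i, α i = k + 1 := by simpa using hα
      rw [← Finset.sum_mul, ← Nat.cast_sum, this]
      push_cast
      rfl
    rw [Finset.mul_sum, Finset.sum_congr rfl h1, Finset.sum_comm]
    simp only [sum_piAntidiag_succ, prod_pow_add_single]
    rw [Finset.sum_comm]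
    refine Finset.sum_congr rfl fun β _ => ?_
    rw [hD, Finset.sum_mul]
    exact Finset.sum_congr rfl fun i _ => by ring
  have hle : ∑ β ∈ Finset.univ.piAntidiag k, D β * ∏ i, ‖w i‖ ^ β i ≤
      (k + 1) * (Real.exp 1 * M) * (Real.exp (k * recip q) *
        ((Finset.univ.piAntidiag k : Finset (Fin n → ℕ)).card : ℝ) ^ (1 - recip q)) := by
    refine le_trans (Finset.sum_le_sum fun β hβ =>
      mul_le_mul_of_nonneg_right (hcoef β hβ) (by positivity)) ?_
    simp only [mul_assoc _ _ (∏ i, ‖w i‖ ^ _)]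
    rw [← Finset.mul_sum]
    gcongr
    exact sum_multinomial_rpow_mul_le hw k
  rw [← hsum, mul_assoc] at hle
  rw [mul_assoc] at hle
  have := le_of_mul_le_mul_left hle (by positivity)
  calc _ ≤ _ := this
    _ = _ := by ring

/-! ### Counting monomials -/

/-- The count is a Taylor coefficient of the generating function `(1-x)^{-n}`, all of whose
coefficients are nonnegative. -/
theorem card_piAntidiag_mul_pow_le {n k : ℕ} {x : ℝ} (hx0 : 0 ≤ x) (hx1 : x < 1) :
    ((Finset.univ.piAntidiag k : Finset (Fin n → ℕ)).card : ℝ) * x ^ k ≤ (1 - x)⁻¹ ^ n := by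
  have h1 : ((Finset.univ.piAntidiag k : Finset (Fin n → ℕ)).card : ℝ) * x ^ k =
      ∑ β ∈ (Finset.univ.piAntidiag k : Finset (Fin n → ℕ)), ∏ i, x ^ β i := by
    rw [← nsmul_eq_mul, ← Finset.sum_const]
    refine Finset.sum_congr rfl fun β hβ => ?_
    have : ∑ i, β i = k := by simpa using hβ
    rw [Finset.prod_pow_eq_pow_sum, this]
  have hsub : (Finset.univ.piAntidiag k : Finset (Fin n → ℕ)) ⊆
      Fintype.piFinset fun _ => Finset.range (k + 1) := by
    intro β hβ
    have : ∑ i, β i = k := by simpa using hβ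
    simp only [Fintype.mem_piFinset, Finset.mem_range]
    intro i
    have := Finset.single_le_sum (f := β) (fun _ _ => Nat.zero_le _) (Finset.mem_univ i)
    omega
  rw [h1]
  calc _ ≤ ∑ β ∈ Fintype.piFinset fun _ : Fin n => Finset.range (k + 1), ∏ i, x ^ β i :=
        Finset.sum_le_sum_of_subset_of_nonneg hsub fun _ _ _ => by positivity
    _ = ∏ _i : Fin n, ∑ j ∈ Finset.range (k + 1), x ^ j :=
        (Finset.prod_univ_sum (fun _ : Fin n => Finset.range (k + 1)) fun _ j => x ^ j).symm
    _ = (∑ j ∈ Finset.range (k + 1), x ^ j) ^ n := by simp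
    _ ≤ _ := by
        gcongr
        rw [← tsum_geometric_of_lt_one hx0 hx1]
        exact (summable_geometric_of_lt_one hx0 hx1).sum_le_tsum _ fun _ _ => by positivity

theorem log_le_half {y : ℝ} (hy : 0 < y) : Real.log y ≤ y / 2 := by
  have h1 := Real.log_le_sub_one_of_pos (x := y / Real.exp 1) (by positivity)
  rw [Real.log_div hy.ne' (Real.exp_pos 1).ne', Real.log_exp] at h1
  have h2 : y / Real.exp 1 ≤ y / 2 := by
    gcongr
    linarith [Real.add_one_le_exp (1 : ℝ)]
  linarith

theorem card_piAntidiag_le {n : ℕ} (hn : 2 ≤ n) (k : ℕ) :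
    ((Finset.univ.piAntidiag k : Finset (Fin n → ℕ)).card : ℝ) ≤
      Real.exp k * (n / Real.log n) ^ (k + 1) := by
  have hn' : (2 : ℝ) ≤ n := by exact_mod_cast hn
  have hn0 : (0 : ℝ) < n := by linarith
  set L := Real.log n with hL
  have hL0 : 0 < L := Real.log_pos (by linarith)
  have hLn : L ≤ n / 2 := log_le_half hn0
  have he : (2.5 : ℝ) ≤ Real.exp 1 := by linarith [Real.exp_one_gt_d9]
  -- With this `x` the factor `x^{-k}` is exactly `(e n / log n)^k`. Since `e(1-x) ≥ 2`, the
  -- generating function is at most `e^{L/2} = √n`, and `√n ≤ n / log n`.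
  set x : ℝ := L / (Real.exp 1 * n) with hx
  have hx0 : 0 < x := by positivity
  have hxn : n * x = L / Real.exp 1 := by rw [hx]; field_simp
  have hx5 : x ≤ 1 / 5 := by
    rw [hx, div_le_iff₀ (by positivity)]
    nlinarith
  have hgen := card_piAntidiag_mul_pow_le (n := n) (k := k) hx0.le (by linarith : x < 1)
  have hgeo : (1 - x)⁻¹ ^ n ≤ n / L := by
    have h1 : (1 - x)⁻¹ ≤ Real.exp (x / (1 - x)) := by
      have := Real.add_one_le_exp (x / (1 - x))
      have h2 : x / (1 - x) + 1 = (1 - x)⁻¹ := by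
        have : 1 - x ≠ 0 := by linarith
        field_simp
        ring
      linarith
    have h3 : (1 - x)⁻¹ ^ n ≤ Real.exp (L / 2) := by
      calc _ ≤ Real.exp (x / (1 - x)) ^ n := by
            gcongr
            exact inv_nonneg.2 (by linarith)
        _ = Real.exp (n * x / (1 - x)) := by rw [← Real.exp_nat_mul]; ring_nf
        _ ≤ _ := by
            rw [Real.exp_le_exp, hxn, div_div]
            exact div_le_div_of_nonneg_left hL0.le two_pos (by nlinarith)
    have h4 : Real.exp (L / 2) * Real.exp (L / 2) = n := by
      rw [← Real.exp_add, add_halves, hL, Real.exp_log hn0]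
    have h5 : L ≤ Real.exp (L / 2) := by
      have := log_le_half (Real.exp_pos (L / 2))
      rw [Real.log_exp] at this
      linarith
    refine h3.trans ?_
    rw [le_div_iff₀ hL0]
    nlinarith [Real.exp_pos (L / 2)]
  have hxk : 0 < x ^ k := by positivity
  have h6 : Real.exp k * (n / L) ^ (k + 1) = (n / L) / x ^ k := by
    have h7 : Real.exp 1 * (n / L) * x = 1 := by rw [hx]; field_simp
    rw [← mul_one (k : ℝ), Real.exp_nat_mul, eq_div_iff hxk.ne']
    calc _ = (Real.exp 1 * (n / L) * x) ^ k * (n / L) := by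
          rw [mul_pow, mul_pow, pow_succ]; ring
      _ = n / L := by rw [h7, one_pow, one_mul]
  rw [h6, le_div_iff₀ hxk]
  exact hgen.trans hgeo

/-- The coefficient sum of a scalar homogeneous polynomial on `ℓ_q^n`. -/
theorem sum_norm_coeff_le {n k : ℕ} {q : ℝ≥0∞} [hq : Fact (1 ≤ q)] (hn : 2 ≤ n ∨ recip q = 1)
    {c : (Fin n → ℕ) → ℂ} {M : ℝ} (hM : 0 ≤ M)
    (hP : ∀ u : PiLp q (fun _ : Fin n => ℂ),
      ‖∑ α ∈ Finset.univ.piAntidiag (k + 1), c α * ∏ i, u i ^ α i‖ ≤ M * ‖u‖ ^ (k + 1))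
    {w : PiLp q (fun _ : Fin n => ℂ)} (hw : ‖w‖ ≤ 1) :
    ∑ α ∈ Finset.univ.piAntidiag (k + 1), ‖c α‖ * ∏ i, ‖w i‖ ^ α i ≤
      (Real.exp 1 * ((n : ℝ) / Real.log n) ^ (1 - recip q)) ^ (k + 1) * M := by
  refine (sum_norm_coeff_le_card hM hP hw).trans ?_
  have h0 : 0 ≤ 1 - recip q := sub_nonneg.2 (recip_le_one hq.out)
  have hL : 0 ≤ Real.log n := Real.log_natCast_nonneg n
  set Q : ℝ := (n : ℝ) / Real.log n with hQ
  have hQ0 : 0 ≤ Q := by positivity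
  have hN : ((Finset.univ.piAntidiag k : Finset (Fin n → ℕ)).card : ℝ) ^ (1 - recip q) ≤
      Real.exp (k * (1 - recip q)) * (Q ^ (1 - recip q)) ^ (k + 1) := by
    -- The second alternative admits `n = 1`, where `log n = 0`: the exponent `1 - 1/q` is then zero
    -- and the powers equal `1`.
    rcases hn with hn | hq1
    · calc _ ≤ (Real.exp k * Q ^ (k + 1)) ^ (1 - recip q) := by
            gcongr
            exact card_piAntidiag_le hn k
        _ = _ := by
            rw [Real.mul_rpow (by positivity) (by positivity), ← Real.exp_mul,
              ← Real.rpow_natCast, ← Real.rpow_natCast, ← Real.rpow_mul hQ0, ← Real.rpow_mul hQ0,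
              mul_comm (1 - recip q)]
    · simp [hq1]
  calc Real.exp 1 * M * (Real.exp (k * recip q) *
        ((Finset.univ.piAntidiag k : Finset (Fin n → ℕ)).card : ℝ) ^ (1 - recip q))
      ≤ Real.exp 1 * M * (Real.exp (k * recip q) *
        (Real.exp (k * (1 - recip q)) * (Q ^ (1 - recip q)) ^ (k + 1))) := by gcongr
    _ = Real.exp 1 * (Real.exp (k * recip q) * Real.exp (k * (1 - recip q))) *
        (Q ^ (1 - recip q)) ^ (k + 1) * M := by ring
    _ = _ := by
        rw [← Real.exp_add, ← Real.exp_add, mul_pow, ← Real.exp_nat_mul]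
        congr 3
        push_cast
        ring

/-! ### From scalar to vector coefficients: the 1-summing norm -/

section Summing

variable {X : Type*} [NormedAddCommGroup X] [NormedSpace ℂ X]

theorem one_le_oneSummingNorm_id [Nontrivial X] :
    1 ≤ oneSummingNorm (ContinuousLinearMap.id ℂ X) := by
  refine le_sInf fun C hC => ?_
  obtain ⟨x, hx⟩ := exists_ne (0 : X)
  have h := hC 1 (fun _ => x)
  have hsup : (⨆ φ ∈ Metric.ball (0 : StrongDual ℂ X) 1, ∑ j : Fin 1, ‖φ x‖ₑ) ≤ ‖x‖ₑ := by
    refine iSup₂_le fun φ hφ => ?_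
    simp only [Finset.univ_unique, Finset.sum_const, Finset.card_singleton, one_smul]
    rw [enorm_le_iff_norm_le]
    have h1 : ‖φ‖ ≤ 1 := by simpa using (Metric.mem_ball.1 hφ).le
    calc _ ≤ ‖φ‖ * ‖x‖ := φ.le_opNorm x
      _ ≤ _ := mul_le_of_le_one_left (norm_nonneg _) h1
  have h2 : ‖x‖ₑ ≤ C * ‖x‖ₑ := by
    refine le_trans ?_ (h.trans (mul_le_mul_right hsup C))
    simp
  have hx0 : ‖x‖ₑ ≠ 0 := by simpa using hx
  by_contra hlt
  rw [not_le] at hlt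
  have : C * ‖x‖ₑ < 1 * ‖x‖ₑ := (ENNReal.mul_lt_mul_iff_left hx0 enorm_ne_top).2 hlt
  rw [one_mul] at this
  exact absurd h2 (not_le.2 this)

/-- Expanding in a basis reduces the claim to the coordinate functionals, each scaled into the open
dual ball. -/
theorem oneSummingNorm_id_ne_top [FiniteDimensional ℂ X] :
    oneSummingNorm (ContinuousLinearMap.id ℂ X) ≠ ∞ := by
  let b := Module.finBasis ℂ X
  let ψ : Fin (Module.finrank ℂ X) → StrongDual ℂ X := fun i => LinearMap.toContinuousLinearMap (b.coord i)
  have hrepr : ∀ x : X, x = ∑ i, ψ i x • b i := fun x => by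
    simp [ψ]
  set C : ℝ≥0∞ := ∑ i, ‖b i‖ₑ * ENNReal.ofReal (‖ψ i‖ + 1) with hC
  have hCtop : C ≠ ∞ := by
    rw [hC]
    exact ENNReal.sum_ne_top.2 fun i _ => ENNReal.mul_ne_top enorm_ne_top ENNReal.ofReal_ne_top
  refine ne_top_of_le_ne_top hCtop (sInf_le ?_)
  intro k x
  set S : ℝ≥0∞ := ⨆ φ ∈ Metric.ball (0 : StrongDual ℂ X) 1, ∑ j, ‖φ (x j)‖ₑ with hS
  have hψ : ∀ i, ∑ j, ‖ψ i (x j)‖ₑ ≤ ENNReal.ofReal (‖ψ i‖ + 1) * S := by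
    intro i
    have hpos : (0 : ℝ) < ‖ψ i‖ + 1 := by positivity
    have hmem : (((‖ψ i‖ + 1)⁻¹ : ℝ) : ℂ) • ψ i ∈ Metric.ball (0 : StrongDual ℂ X) 1 := by
      rw [mem_ball_zero_iff, norm_smul, Complex.norm_real, Real.norm_of_nonneg (by positivity),
        inv_mul_lt_iff₀ hpos]
      linarith
    have h1 : ∑ j, ‖((((‖ψ i‖ + 1)⁻¹ : ℝ) : ℂ) • ψ i) (x j)‖ₑ ≤ S :=
      le_iSup₂ (f := fun (φ : StrongDual ℂ X) (_ : φ ∈ Metric.ball (0 : StrongDual ℂ X) 1) =>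
        ∑ j, ‖φ (x j)‖ₑ) _ hmem
    calc _ = ENNReal.ofReal (‖ψ i‖ + 1) *
          ∑ j, ‖((((‖ψ i‖ + 1)⁻¹ : ℝ) : ℂ) • ψ i) (x j)‖ₑ := by
            rw [Finset.mul_sum]
            refine Finset.sum_congr rfl fun j _ => ?_
            rw [← ofReal_norm, ← ofReal_norm, ← ENNReal.ofReal_mul hpos.le]
            congr 1
            rw [smul_apply, norm_smul, Complex.norm_real,
              Real.norm_of_nonneg (by positivity)]
            field_simp
      _ ≤ _ := by gcongr
  calc ∑ j, ‖ContinuousLinearMap.id ℂ X (x j)‖ₑ ≤ ∑ j, ∑ i, ‖ψ i (x j)‖ₑ * ‖b i‖ₑ := by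
        refine Finset.sum_le_sum fun j _ => ?_
        rw [ContinuousLinearMap.id_apply]
        conv_lhs => rw [hrepr (x j)]
        refine (enorm_sum_le _ _).trans (le_of_eq ?_)
        simp only [enorm_smul]
    _ = ∑ i, ‖b i‖ₑ * ∑ j, ‖ψ i (x j)‖ₑ := by
        rw [Finset.sum_comm]
        refine Finset.sum_congr rfl fun i _ => ?_
        rw [Finset.mul_sum]
        exact Finset.sum_congr rfl fun j _ => mul_comm _ _
    _ ≤ ∑ i, ‖b i‖ₑ * (ENNReal.ofReal (‖ψ i‖ + 1) * S) := by
        gcongr with i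
        exact hψ i
    _ = C * S := by simp only [hC, Finset.sum_mul, mul_assoc]

/-- The infimum defining `π_1` is attained as a constant. When the bound vanishes one cannot divide
by it, and the existence of some admissible constant is used instead. -/
theorem sum_enorm_le_oneSummingNorm_mul [FiniteDimensional ℂ X] {ι : Type*} (s : Finset ι)
    (x : ι → X) {K : ℝ} (h : ∀ φ : StrongDual ℂ X, ‖φ‖ < 1 → ∑ i ∈ s, ‖φ (x i)‖ ≤ K) :
    ∑ i ∈ s, ‖x i‖ₑ ≤ oneSummingNorm (ContinuousLinearMap.id ℂ X) * ENNReal.ofReal K := by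
  have hreindex : ∀ g : ι → ℝ≥0∞, ∑ j, g (s.equivFin.symm j) = ∑ i ∈ s, g i := by
    intro g
    rw [← Finset.sum_coe_sort s g]
    exact s.equivFin.symm.sum_comp (fun i => g i)
  set S : Set ℝ≥0∞ := {C : ℝ≥0∞ | ∀ (k : ℕ) (x : Fin k → X),
    ∑ j, ‖ContinuousLinearMap.id ℂ X (x j)‖ₑ ≤
      C * ⨆ φ ∈ Metric.ball (0 : StrongDual ℂ X) 1, ∑ j, ‖φ (x j)‖ₑ} with hS
  have hmem : ∀ C ∈ S, ∑ i ∈ s, ‖x i‖ₑ ≤ C * ENNReal.ofReal K := by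
    intro C hC
    have h1 := hC s.card (fun j => x (s.equivFin.symm j))
    simp only [ContinuousLinearMap.id_apply] at h1
    rw [hreindex (fun i => ‖x i‖ₑ)] at h1
    refine h1.trans ?_
    gcongr
    refine iSup₂_le fun φ hφ => ?_
    rw [hreindex (fun i => ‖φ (x i)‖ₑ)]
    simp only [← ofReal_norm]
    rw [← ENNReal.ofReal_sum_of_nonneg fun _ _ => norm_nonneg _]
    exact ENNReal.ofReal_le_ofReal (h φ (by simpa using hφ))
  have hne : S.Nonempty := by
    by_contra hempty
    rw [Set.not_nonempty_iff_eq_empty] at hempty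
    apply oneSummingNorm_id_ne_top (X := X)
    change sInf S = ∞
    rw [hempty, sInf_empty]
  rcases eq_or_ne (ENNReal.ofReal K) 0 with h0 | h0
  · obtain ⟨C, hC⟩ := hne
    simpa [h0] using hmem C hC
  · rw [← ENNReal.div_le_iff h0 ENNReal.ofReal_ne_top]
    refine le_sInf fun C hC => ?_
    rw [ENNReal.div_le_iff h0 ENNReal.ofReal_ne_top]
    exact hmem C hC

/-- Rescaling `u` by `1/t` with `t > ‖u‖` keeps it in the open ball; letting `t` decrease to `‖u‖`
also covers `u = 0`. -/
theorem norm_homogeneous_le {n m : ℕ} {q : ℝ≥0∞} [Fact (1 ≤ q)] {x : (Fin n → ℕ) → X} {M : ℝ}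
    (h : ∀ u : PiLp q (fun _ : Fin n => ℂ), ‖u‖ < 1 →
      ‖∑ α ∈ Finset.univ.piAntidiag m, (∏ i, u i ^ α i) • x α‖ ≤ M)
    (u : PiLp q (fun _ : Fin n => ℂ)) :
    ‖∑ α ∈ Finset.univ.piAntidiag m, (∏ i, u i ^ α i) • x α‖ ≤ M * ‖u‖ ^ m := by
  have key : ∀ t : ℝ, ‖u‖ < t →
      ‖∑ α ∈ Finset.univ.piAntidiag m, (∏ i, u i ^ α i) • x α‖ ≤ M * t ^ m := by
    intro t ht
    have ht0 : 0 < t := (norm_nonneg u).trans_lt ht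
    have h1 := h (((t⁻¹ : ℝ) : ℂ) • u) (by
      rw [norm_smul, Complex.norm_real, Real.norm_of_nonneg (by positivity), inv_mul_lt_iff₀ ht0]
      linarith)
    have h2 : ∑ α ∈ Finset.univ.piAntidiag m,
        (∏ i, (((t⁻¹ : ℝ) : ℂ) • u) i ^ α i) • x α = (((t⁻¹ : ℝ) : ℂ) ^ m) •
          ∑ α ∈ Finset.univ.piAntidiag m, (∏ i, u i ^ α i) • x α := by
      rw [Finset.smul_sum]
      refine Finset.sum_congr rfl fun α hα => ?_
      have : ∑ i, α i = m := by simpa using hα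
      simp only [PiLp.smul_apply, smul_eq_mul, mul_pow, Finset.prod_mul_distrib,
        Finset.prod_pow_eq_pow_sum, this, smul_smul]
    rw [h2, norm_smul, norm_pow, Complex.norm_real, Real.norm_of_nonneg (by positivity), inv_pow,
      inv_mul_le_iff₀ (by positivity)] at h1
    linarith
  have hcont : Filter.Tendsto (fun t : ℝ => M * t ^ m) (nhdsWithin ‖u‖ (Set.Ioi ‖u‖))
      (nhds (M * ‖u‖ ^ m)) :=
    ((continuous_const.mul (continuous_pow m)).tendsto _).mono_left nhdsWithin_le_nhds
  exact ge_of_tendsto hcont (Filter.eventually_of_mem self_mem_nhdsWithin fun t ht => key t ht)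

/-- The scalar estimate is applied to `φ ∘ P` for all functionals `φ` of norm below one, `P` being
the polynomial with coefficients `x α`. -/
theorem sum_enorm_homogeneous_le [FiniteDimensional ℂ X] {n k : ℕ} {q : ℝ≥0∞} [Fact (1 ≤ q)]
    (hn : 2 ≤ n ∨ recip q = 1) {x : (Fin n → ℕ) → X} {M : ℝ}
    (h : ∀ u : PiLp q (fun _ : Fin n => ℂ), ‖u‖ < 1 →
      ‖∑ α ∈ Finset.univ.piAntidiag (k + 1), (∏ i, u i ^ α i) • x α‖ ≤ M)
    {w : PiLp q (fun _ : Fin n => ℂ)} (hw : ‖w‖ ≤ 1) :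
    ∑ α ∈ Finset.univ.piAntidiag (k + 1), ‖(∏ i, w i ^ α i) • x α‖ₑ ≤
      oneSummingNorm (ContinuousLinearMap.id ℂ X) * ENNReal.ofReal
        ((Real.exp 1 * ((n : ℝ) / Real.log n) ^ (1 - recip q)) ^ (k + 1) * M) := by
  have hM : 0 ≤ M := (norm_nonneg _).trans (h 0 (by simp))
  refine sum_enorm_le_oneSummingNorm_mul _ _ fun φ hφ => ?_
  have h1 := sum_norm_coeff_le (k := k) (c := fun α => φ (x α)) hn hM (fun u => ?_) hw
  · refine le_trans (le_of_eq (Finset.sum_congr rfl fun α _ => ?_)) h1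
    simp [norm_prod, mul_comm]
  · have h2 := norm_homogeneous_le h u
    calc _ = ‖φ (∑ α ∈ Finset.univ.piAntidiag (k + 1), (∏ i, u i ^ α i) • x α)‖ := by
          simp [mul_comm]
      _ ≤ ‖φ‖ * ‖∑ α ∈ Finset.univ.piAntidiag (k + 1), (∏ i, u i ^ α i) • x α‖ := φ.le_opNorm _
      _ ≤ 1 * ‖∑ α ∈ Finset.univ.piAntidiag (k + 1), (∏ i, u i ^ α i) • x α‖ := by gcongr
      _ ≤ _ := by rwa [one_mul]

end Summing

/-! ### Bohr sums and the lower estimate -/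

theorem tsum_eq_tsum_sum_piAntidiag {n : ℕ} (F : (Fin n → ℕ) → ℝ≥0∞) :
    ∑' α, F α = ∑' m, ∑ α ∈ Finset.univ.piAntidiag m, F α := by
  rw [← (Equiv.sigmaFiberEquiv (fun α : Fin n → ℕ => ∑ i, α i)).tsum_eq F,
    ENNReal.tsum_sigma']
  refine tsum_congr fun m => ?_
  rw [← Finset.tsum_subtype]
  refine (Equiv.subtypeEquivRight fun α => ?_).tsum_eq
    (fun β : {α // α ∈ (Finset.univ.piAntidiag m : Finset (Fin n → ℕ))} => F β)
  simp

section

variable {X : Type*} [NormedAddCommGroup X] [NormedSpace ℂ X] [FiniteDimensional ℂ X]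
  {n : ℕ} {q : ℝ≥0∞} [hq : Fact (1 ≤ q)]
  {f : PiLp q (fun _ : Fin n => ℂ) → X} {x : (Fin n → ℕ) → X}

/-- In finite dimension unconditional convergence is absolute. -/
theorem IsHolomorphicWithExpansion.summable_norm (hf : IsHolomorphicWithExpansion n q f x)
    {w : PiLp q (fun _ : Fin n => ℂ)} (hw : ‖w‖ < 1) :
    Summable fun α => ‖(∏ i, w i ^ α i) • x α‖ := by
  have : FiniteDimensional ℝ X := FiniteDimensional.complexToReal X
  exact summable_norm_iff.2 (hf.2 w (by simpa [lqBall] using hw)).summable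

theorem IsHolomorphicWithExpansion.norm_homogeneous_part_le
    (hf : IsHolomorphicWithExpansion n q f x) {M : ℝ}
    (hM : ∀ z : PiLp q (fun _ : Fin n => ℂ), ‖z‖ < 1 → ‖f z‖ ≤ M)
    {w : PiLp q (fun _ : Fin n => ℂ)} (hw : ‖w‖ < 1) (m : ℕ) :
    ‖∑ α ∈ Finset.univ.piAntidiag m, (∏ i, w i ^ α i) • x α‖ ≤ M := by
  have : CompleteSpace X := FiniteDimensional.complete ℂ X
  have h := norm_tsum_ite_le_of_circle_bound (hf.summable_norm hw) (fun α => ∑ i, α i) (M := M)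
    (fun ζ hζ => ?_) m
  · rw [tsum_eq_sum (s := Finset.univ.piAntidiag m)] at h
    · refine le_of_eq_of_le ?_ h
      congr 1
      refine Finset.sum_congr rfl fun α hα => ?_
      rw [if_pos (by simpa using hα)]
    · intro α hα
      rw [if_neg (by simpa using hα)]
  · have hζw : ‖ζ • w‖ < 1 := by rwa [norm_smul, hζ, one_mul]
    have h2 := (hf.2 (ζ • w) (by simpa [lqBall] using hζw)).tsum_eq
    refine le_of_eq_of_le ?_ (hM _ hζw)
    rw [← h2]
    congr 1
    refine tsum_congr fun α => ?_
    simp only [monomialAt, PiLp.smul_apply, smul_eq_mul, mul_pow, Finset.prod_mul_distrib,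
      Finset.prod_pow_eq_pow_sum, smul_smul]

theorem IsHolomorphicWithExpansion.norm_term_le
    (hf : IsHolomorphicWithExpansion n q f x) {M : ℝ}
    (hM : ∀ z : PiLp q (fun _ : Fin n => ℂ), ‖z‖ < 1 → ‖f z‖ ≤ M)
    {w : PiLp q (fun _ : Fin n => ℂ)} (hw : ‖w‖ < 1) (α : Fin n → ℕ) :
    ‖(∏ i, w i ^ α i) • x α‖ ≤ M := by
  have : CompleteSpace X := FiniteDimensional.complete ℂ X
  refine norm_coeff_le_of_torus_bound (hf.summable_norm hw) (fun θ hθ => ?_) α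
  set u : PiLp q (fun _ : Fin n => ℂ) := WithLp.toLp q fun i => θ i * w i with hu
  have hu1 : ‖u‖ < 1 := (lq_norm_mono (by intro i; simp [hu, hθ])).trans_lt hw
  have h2 := (hf.2 u (by simpa [lqBall] using hu1)).tsum_eq
  refine le_of_eq_of_le ?_ (hM _ hu1)
  rw [← h2]
  congr 1
  refine tsum_congr fun α => ?_
  simp only [monomialAt, hu, mul_pow, Finset.prod_mul_distrib, smul_smul]

/-- For `1 ≤ p`, the `ℓ_p`-sum of the terms of degree `k+1`. -/
theorem IsHolomorphicWithExpansion.sum_enorm_rpow_le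
    (hf : IsHolomorphicWithExpansion n q f x) (hn : 2 ≤ n ∨ recip q = 1) {p : ℝ} (hp : 1 ≤ p)
    {M : ℝ} (hM : ∀ z : PiLp q (fun _ : Fin n => ℂ), ‖z‖ < 1 → ‖f z‖ ≤ M)
    {w : PiLp q (fun _ : Fin n => ℂ)} (hw : ‖w‖ < 1) (k : ℕ) :
    ∑ α ∈ Finset.univ.piAntidiag (k + 1), ‖(∏ i, w i ^ α i) • x α‖ₑ ^ p ≤
      oneSummingNorm (ContinuousLinearMap.id ℂ X) * ENNReal.ofReal
        ((Real.exp 1 * ((n : ℝ) / Real.log n) ^ (1 - recip q)) ^ (k + 1)) *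
        ENNReal.ofReal M ^ p := by
  have hsum := sum_enorm_homogeneous_le (k := k) hn
    (fun u hu => hf.norm_homogeneous_part_le hM hu (k + 1)) hw.le
  have hL : 0 ≤ Real.log n := Real.log_natCast_nonneg n
  have hsplit : ∀ a : ℝ≥0∞, a ^ p = a ^ (p - 1) * a := by
    intro a
    conv_rhs => rw [← ENNReal.rpow_one a, ← ENNReal.rpow_mul, mul_comm]
    rw [one_mul, ← ENNReal.rpow_add_of_nonneg _ _ zero_le_one (by linarith)]
    congr 1
    ring
  rw [hsplit (ENNReal.ofReal M)]
  -- Interpolation: `p - 1` of the `p` factors are estimated by the uniform bound on single terms,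
  -- and the remaining one is summed in `ℓ_1`.
  calc _ ≤ ∑ α ∈ Finset.univ.piAntidiag (k + 1),
        ENNReal.ofReal M ^ (p - 1) * ‖(∏ i, w i ^ α i) • x α‖ₑ := by
        refine Finset.sum_le_sum fun α _ => ?_
        rw [hsplit]
        gcongr
        rw [← ofReal_norm]
        exact ENNReal.ofReal_le_ofReal (hf.norm_term_le hM hw α)
    _ = ENNReal.ofReal M ^ (p - 1) *
        ∑ α ∈ Finset.univ.piAntidiag (k + 1), ‖(∏ i, w i ^ α i) • x α‖ₑ := by
        rw [Finset.mul_sum]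
    _ ≤ ENNReal.ofReal M ^ (p - 1) * (oneSummingNorm (ContinuousLinearMap.id ℂ X) *
        ENNReal.ofReal ((Real.exp 1 * ((n : ℝ) / Real.log n) ^ (1 - recip q)) ^ (k + 1) * M)) := by
        gcongr
    _ = _ := by
        rw [ENNReal.ofReal_mul (by positivity)]
        ring

end

/-- The hypothesis makes degree `m` contribute at most `t^m` times the supremum, `t = (λ-1)/(2λ-1)`;
the constant term is bounded directly and carries no factor `π_1`. -/
theorem isBohrAdmissible_of_forall_degree {X : Type*} [NormedAddCommGroup X] [NormedSpace ℂ X]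
    [FiniteDimensional ℂ X] {n : ℕ} {q : ℝ≥0∞} [hq : Fact (1 ≤ q)] (hn : 2 ≤ n ∨ recip q = 1)
    {p lam : ℝ} (hp : 1 ≤ p) (hlam : 1 < lam) {R : ℝ≥0}
    (hR : ∀ k : ℕ, ((R : ℝ≥0∞) ^ (k + 1)) ^ p *
      (oneSummingNorm (ContinuousLinearMap.id ℂ X) * ENNReal.ofReal
        ((Real.exp 1 * ((n : ℝ) / Real.log n) ^ (1 - recip q)) ^ (k + 1))) ≤
      ENNReal.ofReal ((lam - 1) / (2 * lam - 1)) ^ (k + 1)) :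
    IsBohrAdmissible p n q (ContinuousLinearMap.id ℂ X) lam R := by
  intro f x hf
  have hp0 : 0 < p := by linarith
  set S : ℝ≥0∞ := ⨆ z ∈ lqBall n q, ‖f z‖ₑ ^ p with hS
  rcases eq_or_ne S ∞ with hStop | hStop
  · rw [hStop, ENNReal.mul_top (by simp; linarith)]
    exact le_top
  set M : ℝ := (S ^ (1 / p)).toReal with hMdef
  have hSp : S ^ (1 / p) ≠ ∞ := ENNReal.rpow_ne_top_of_nonneg (by positivity) hStop
  have hMS : ENNReal.ofReal M ^ p = S := by
    rw [hMdef, ENNReal.ofReal_toReal hSp, ← ENNReal.rpow_mul, one_div_mul_cancel hp0.ne',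
      ENNReal.rpow_one]
  have hM0 : 0 ≤ M := ENNReal.toReal_nonneg
  have hM : ∀ z : PiLp q (fun _ : Fin n => ℂ), ‖z‖ < 1 → ‖f z‖ ≤ M := by
    intro z hz
    have h1 : ‖f z‖ₑ ^ p ≤ S :=
      le_iSup₂ (f := fun (z : PiLp q (fun _ : Fin n => ℂ)) (_ : z ∈ lqBall n q) => ‖f z‖ₑ ^ p) z
        (by simpa [lqBall] using hz)
    rw [← hMS, ENNReal.rpow_le_rpow_iff hp0, ← ofReal_norm] at h1
    exact (ENNReal.ofReal_le_ofReal_iff hM0).1 h1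
  set t : ℝ := (lam - 1) / (2 * lam - 1) with ht
  have h2l : 0 < 2 * lam - 1 := by linarith
  have ht0 : 0 ≤ t := div_nonneg (by linarith) h2l.le
  refine iSup₂_le fun z hz => ?_
  obtain ⟨w, hw, rfl⟩ := Set.mem_smul_set.1 hz
  have hw1 : ‖w‖ < 1 := by simpa [lqBall] using hw
  rw [tsum_eq_tsum_sum_piAntidiag]
  have hdeg : ∀ m, ∑ α ∈ Finset.univ.piAntidiag m,
      ‖monomialAt (((R : ℝ) : ℂ) • w) α • ContinuousLinearMap.id ℂ X (x α)‖ₑ ^ p ≤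
        ENNReal.ofReal t ^ m * S := by
    intro m
    have hterm : ∀ α ∈ Finset.univ.piAntidiag m,
        ‖monomialAt (((R : ℝ) : ℂ) • w) α • ContinuousLinearMap.id ℂ X (x α)‖ₑ ^ p =
          ((R : ℝ≥0∞) ^ m) ^ p * ‖(∏ i, w i ^ α i) • x α‖ₑ ^ p := by
      intro α hα
      have hα' : ∑ i, α i = m := by simpa using hα
      have : monomialAt (((R : ℝ) : ℂ) • w) α • ContinuousLinearMap.id ℂ X (x α) =
          (((R : ℝ) : ℂ) ^ m) • ((∏ i, w i ^ α i) • x α) := by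
        simp only [monomialAt, PiLp.smul_apply, smul_eq_mul, mul_pow, Finset.prod_mul_distrib,
          Finset.prod_pow_eq_pow_sum, smul_smul, hα', ContinuousLinearMap.id_apply]
      rw [this, enorm_smul, ENNReal.mul_rpow_of_nonneg _ _ hp0.le]
      congr 2
      rw [enorm_pow]
      congr 1
      rw [← ofReal_norm, Complex.norm_real, Real.norm_of_nonneg R.coe_nonneg, ENNReal.ofReal_coe_nnreal]
    rw [Finset.sum_congr rfl hterm, ← Finset.mul_sum]
    rcases m with _ | k
    · have h0 := hf.norm_term_le hM hw1 0
      have : ‖x 0‖ₑ ^ p ≤ S := by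
        rw [← hMS]
        gcongr
        rw [← ofReal_norm]
        exact ENNReal.ofReal_le_ofReal (by simpa using h0)
      simpa using this
    · calc _ ≤ ((R : ℝ≥0∞) ^ (k + 1)) ^ p * (oneSummingNorm (ContinuousLinearMap.id ℂ X) *
            ENNReal.ofReal ((Real.exp 1 * ((n : ℝ) / Real.log n) ^ (1 - recip q)) ^ (k + 1)) *
              ENNReal.ofReal M ^ p) := by
            gcongr
            exact hf.sum_enorm_rpow_le hn hp hM hw1 k
        _ = _ := by rw [hMS, ← mul_assoc]
        _ ≤ _ := by
            gcongr
            exact hR k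
  calc _ ≤ ∑' m, ENNReal.ofReal t ^ m * S := ENNReal.tsum_le_tsum hdeg
    _ = (1 - ENNReal.ofReal t)⁻¹ * S := by rw [ENNReal.tsum_mul_right, ENNReal.tsum_geometric]
    _ ≤ _ := by
        gcongr
        -- The sum of the series is `(2λ-1)/λ`, and `(2λ-1)/λ ≤ λ` amounts to `(λ-1)^2 ≥ 0`.
        have h1t : 1 - t = lam / (2 * lam - 1) := by
          rw [ht, eq_div_iff h2l.ne', sub_mul, div_mul_cancel₀ _ h2l.ne']
          ring
        rw [← ENNReal.ofReal_one, ← ENNReal.ofReal_sub _ ht0, h1t,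
          ← ENNReal.ofReal_inv_of_pos (by positivity)]
        refine ENNReal.ofReal_le_ofReal ?_
        rw [inv_div, div_le_iff₀ (by positivity)]
        nlinarith [sq_nonneg (lam - 1)]

section LowerConst

variable (X : Type*) [NormedAddCommGroup X] [NormedSpace ℂ X]

theorem bohrLowerConst_pos [Nontrivial X] [FiniteDimensional ℂ X] : 0 < bohrLowerConst X := by
  have h1 := one_le_oneSummingNorm_id (X := X)
  have h2 := oneSummingNorm_id_ne_top (X := X)
  refine ENNReal.mul_pos (by simp [Real.exp_pos]) (ne_of_gt ?_)
  refine lt_of_lt_of_le (ENNReal.inv_pos.2 h2) (le_iInf fun m => ?_)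
  rw [← ENNReal.rpow_neg_one]
  refine ENNReal.rpow_le_rpow_of_exponent_le h1 ?_
  have hm : (1 : ℝ) ≤ m := by exact_mod_cast m.2
  rw [neg_le_neg_iff, div_le_one (by linarith)]
  exact hm

theorem bohrLowerConst_le_one [Nontrivial X] : bohrLowerConst X ≤ 1 := by
  have h1 := one_le_oneSummingNorm_id (X := X)
  refine mul_le_one' ?_ ((iInf_le _ 1).trans ?_)
  · simp
  · exact ENNReal.rpow_le_one_of_one_le_of_neg h1 (by simp)

/-- Taking `m = k+1` in the infimum: the `(k+1)`-th root of `π_1` absorbs the single factor `π_1`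
occurring in degree `k+1`. -/
theorem bohrLowerConst_pow_mul_le (k : ℕ) :
    bohrLowerConst X ^ (k + 1) * (oneSummingNorm (ContinuousLinearMap.id ℂ X) *
      ENNReal.ofReal (Real.exp 1) ^ (k + 1)) ≤ 1 := by
  set π := oneSummingNorm (ContinuousLinearMap.id ℂ X) with hπ
  have h1 : bohrLowerConst X ≤
      ENNReal.ofReal (Real.exp (-1)) * π ^ (-(1 / ((k + 1 : ℕ) : ℝ))) := by
    refine mul_le_mul_right ((iInf_le _ (⟨k + 1, k.succ_pos⟩ : ℕ+)).trans (le_of_eq ?_)) _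
    rfl
  have hk : ((k + 1 : ℕ) : ℝ) ≠ 0 := by positivity
  have h2 : (π ^ (-(1 / ((k + 1 : ℕ) : ℝ)))) ^ (k + 1) = π⁻¹ := by
    rw [← ENNReal.rpow_natCast, ← ENNReal.rpow_mul, ← ENNReal.rpow_neg_one]
    congr 1
    field_simp
  calc _ ≤ (ENNReal.ofReal (Real.exp (-1)) * π ^ (-(1 / ((k + 1 : ℕ) : ℝ)))) ^ (k + 1) *
        (π * ENNReal.ofReal (Real.exp 1) ^ (k + 1)) := by gcongr
    _ = (ENNReal.ofReal (Real.exp (-1)) * ENNReal.ofReal (Real.exp 1)) ^ (k + 1) * (π⁻¹ * π) := by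
        rw [mul_pow, h2, mul_pow]; ring
    _ ≤ 1 := by
        rw [← ENNReal.ofReal_mul (Real.exp_pos _).le, ← Real.exp_add]
        simp [ENNReal.inv_mul_le_one]

end LowerConst

/-- By conjugation `1/r = 1 - 1/(p q')` and `1/q' = 1 - 1/q`. -/
theorem recip_bohrExponent {p : ℝ} {q : ℝ≥0∞} (hp : 1 ≤ p) (hq : 1 ≤ q) :
    recip (bohrExponent p q) = 1 - (1 - recip q) / p := by
  have hconj : ∀ {s : ℝ≥0∞}, 1 ≤ s → recip s.conjExponent = 1 - recip s := by
    intro s hs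
    have h := (ENNReal.HolderConjugate.conjExponent hs)
    have h2 := ENNReal.HolderConjugate.inv_add_inv_eq_one s s.conjExponent
    have h3 : s⁻¹ ≠ ∞ := by
      rw [ENNReal.inv_ne_top]; exact (zero_lt_one.trans_le hs).ne'
    have h4 : s.conjExponent⁻¹ ≠ ∞ := by
      intro h5; rw [h5] at h2; simp at h2
    have h5 := congrArg ENNReal.toReal h2
    rw [ENNReal.toReal_add h3 h4] at h5
    simp only [recip]
    simp only [ENNReal.toReal_one] at h5
    linarith
  have hq1 : 1 ≤ q.conjExponent := by simp [ENNReal.conjExponent]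
  have hp1 : 1 ≤ ENNReal.ofReal p := by simpa using hp
  rw [bohrExponent, hconj (one_le_mul hp1 hq1), ← hconj hq]
  congr 1
  rw [recip, recip, ENNReal.mul_inv (by simp; left; linarith) (by simp), ENNReal.toReal_mul,
    ENNReal.toReal_inv, ENNReal.toReal_ofReal (by linarith), div_eq_inv_mul]

/-- The lower estimate of the Bohr radius, for all `q`. -/
theorem bohrLowerConst_mul_le_bohrRadiusSpace (X : Type*) [NormedAddCommGroup X] [NormedSpace ℂ X]
    [FiniteDimensional ℂ X] [Nontrivial X] {n : ℕ} (hn : 1 ≤ n) {q : ℝ≥0∞} [hq : Fact (1 ≤ q)]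
    {p lam : ℝ} (hp : 1 ≤ p) (hlam : 1 < lam) {E : ℝ} (hE : E ≤ 0) :
    bohrLowerConst X * ENNReal.ofReal (((lam - 1) / (2 * lam - 1)) ^ (1 / p) * (n : ℝ) ^ E *
      (Real.log n / n) ^ ((1 - recip q) / p)) ≤ bohrRadiusSpace p n q X lam := by
  have hp0 : 0 < p := by linarith
  have hκ : 0 ≤ 1 - recip q := sub_nonneg.2 (recip_le_one hq.out)
  have hL : 0 ≤ Real.log n := Real.log_natCast_nonneg n
  have hn1 : (1 : ℝ) ≤ n := by exact_mod_cast hn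
  have h2l : 0 < 2 * lam - 1 := by linarith
  set t : ℝ := (lam - 1) / (2 * lam - 1) with ht
  have ht0 : 0 ≤ t := div_nonneg (by linarith) h2l.le
  by_cases hcase : 2 ≤ n ∨ recip q = 1
  · set Y : ℝ := (Real.log n / n) ^ (1 - recip q) with hY
    set A : ℝ := ((n : ℝ) / Real.log n) ^ (1 - recip q) with hA
    have hY0 : 0 ≤ Y := by positivity
    have hA0 : 0 ≤ A := by positivity
    have hYA : Y * A = 1 := by
      rcases hcase with h | h
      · have hn2 : (1 : ℝ) < n := by exact_mod_cast h
        have hL0 : 0 < Real.log n := Real.log_pos hn2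
        rw [hY, hA, ← Real.mul_rpow (by positivity) (by positivity)]
        have : Real.log n / n * (n / Real.log n) = 1 := by field_simp
        rw [this, Real.one_rpow]
      · simp [hY, hA, h]
    have hC1 := bohrLowerConst_le_one X
    have hCtop : bohrLowerConst X ≠ ∞ := ne_top_of_le_ne_top ENNReal.one_ne_top hC1
    set ρ : ℝ := t ^ (1 / p) * (n : ℝ) ^ E * (Real.log n / n) ^ ((1 - recip q) / p) with hρ
    have hρ0 : 0 ≤ ρ := by positivity
    have hρp : ρ ^ p ≤ t * Y := by
      rw [hρ, Real.mul_rpow (by positivity) (by positivity),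
        Real.mul_rpow (by positivity) (by positivity), ← Real.rpow_mul ht0,
        ← Real.rpow_mul (by positivity : 0 ≤ Real.log n / n), one_div_mul_cancel hp0.ne',
        div_mul_cancel₀ _ hp0.ne', Real.rpow_one]
      gcongr
      refine mul_le_of_le_one_right ht0 (Real.rpow_le_one (by positivity) ?_ hp0.le)
      exact Real.rpow_le_one_of_one_le_of_nonpos hn1 hE
    set R : ℝ≥0 := (bohrLowerConst X * ENNReal.ofReal ρ).toNNReal with hRdef
    have hR : (R : ℝ≥0∞) = bohrLowerConst X * ENNReal.ofReal ρ :=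
      ENNReal.coe_toNNReal (ENNReal.mul_ne_top hCtop ENNReal.ofReal_ne_top)
    rw [← hR]
    refine le_iSup₂ (f := fun (r : ℝ≥0) (_ : IsBohrAdmissible p n q
      (ContinuousLinearMap.id ℂ X) lam r) => (r : ℝ≥0∞)) R
      (isBohrAdmissible_of_forall_degree hcase hp hlam fun k => ?_)
    rw [hR]
    -- As the constant is at most `1`, its `p`-th power may be replaced by itself, which makes it
    -- independent of `p`.
    have hCp : bohrLowerConst X ^ p ≤ bohrLowerConst X := by
      simpa using ENNReal.rpow_le_rpow_of_exponent_ge hC1 hp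
    have hswap : ((bohrLowerConst X * ENNReal.ofReal ρ) ^ (k + 1)) ^ p ≤
        (bohrLowerConst X * ENNReal.ofReal (t * Y)) ^ (k + 1) := by
      have hcomm : ∀ a : ℝ≥0∞, (a ^ (k + 1)) ^ p = (a ^ p) ^ (k + 1) := by
        intro a
        rw [← ENNReal.rpow_natCast, ← ENNReal.rpow_natCast, ← ENNReal.rpow_mul,
          ← ENNReal.rpow_mul, mul_comm]
      rw [hcomm, ENNReal.mul_rpow_of_nonneg _ _ hp0.le,
        ENNReal.ofReal_rpow_of_nonneg hρ0 hp0.le]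
      gcongr
    calc _ ≤ (bohrLowerConst X * ENNReal.ofReal (t * Y)) ^ (k + 1) *
          (oneSummingNorm (ContinuousLinearMap.id ℂ X) *
            ENNReal.ofReal ((Real.exp 1 * A) ^ (k + 1))) := by gcongr
      _ = (bohrLowerConst X ^ (k + 1) * (oneSummingNorm (ContinuousLinearMap.id ℂ X) *
            ENNReal.ofReal (Real.exp 1) ^ (k + 1))) *
            (ENNReal.ofReal t ^ (k + 1) * ENNReal.ofReal (Y * A) ^ (k + 1)) := by
          rw [ENNReal.ofReal_pow (by positivity), ENNReal.ofReal_mul ht0,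
            ENNReal.ofReal_mul (Real.exp_pos 1).le, ENNReal.ofReal_mul hY0]
          ring
      _ ≤ 1 * (ENNReal.ofReal t ^ (k + 1) * ENNReal.ofReal (Y * A) ^ (k + 1)) := by
          gcongr
          exact bohrLowerConst_pow_mul_le X k
      _ = _ := by rw [hYA]; simp [ht]
  -- Here `n = 1` and `q > 1`, so the claimed lower bound is `0`.
  · push Not at hcase
    have hn' : n = 1 := by omega
    have hpos : 0 < 1 - recip q := lt_of_le_of_ne hκ (sub_ne_zero.2 (Ne.symm hcase.2)).symm
    have h0 : (1 - recip q) / p ≠ 0 := by positivity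
    simp [hn', Real.zero_rpow h0]

/-! ### Choice of signs -/

/-- Choosing signs one at a time so as to keep an exponential moment small. -/
theorem exists_signs_sum_exp_le {ι κ : Type*} [DecidableEq ι] (J : Finset κ) (b : κ → ι → ℝ)
    (s : Finset ι) : ∀ W : κ → ℝ, (∀ j, 0 ≤ W j) → ∃ ε : ι → ℝ, (∀ i, ε i = 1 ∨ ε i = -1) ∧
      ∑ j ∈ J, W j * Real.exp (∑ i ∈ s, ε i * b j i) ≤
        ∑ j ∈ J, W j * Real.exp (∑ i ∈ s, b j i ^ 2 / 2) := by
  induction s using Finset.induction_on with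
  | empty => intro W _; exact ⟨fun _ => 1, fun _ => Or.inl rfl, by simp⟩
  | insert a s ha ih =>
    intro W hW
    -- The sign at `a` is chosen against the moments already charged for the remaining indices; it
    -- then enters the weights. One of the two signs works since `cosh x ≤ e^{x²/2}`.
    set V : κ → ℝ := fun j => W j * Real.exp (∑ i ∈ s, b j i ^ 2 / 2) with hV
    have hV0 : ∀ j, 0 ≤ V j := fun j => mul_nonneg (hW j) (Real.exp_pos _).le
    obtain ⟨e, he, hle⟩ : ∃ e : ℝ, (e = 1 ∨ e = -1) ∧
        ∑ j ∈ J, V j * Real.exp (e * b j a) ≤ ∑ j ∈ J, V j * Real.exp (b j a ^ 2 / 2) := by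
      by_contra! hcon
      have h1 := hcon 1 (Or.inl rfl)
      have h2 := hcon (-1) (Or.inr rfl)
      have h3 : ∑ j ∈ J, V j * Real.exp (1 * b j a) + ∑ j ∈ J, V j * Real.exp (-1 * b j a) ≤
          2 * ∑ j ∈ J, V j * Real.exp (b j a ^ 2 / 2) := by
        rw [← Finset.sum_add_distrib, Finset.mul_sum]
        refine Finset.sum_le_sum fun j _ => ?_
        have := Real.cosh_le_exp_half_sq (b j a)
        rw [Real.cosh_eq] at this
        rw [one_mul, neg_one_mul]
        nlinarith [hV0 j]
      linarith
    obtain ⟨ε, hε, hsum⟩ := ih (fun j => W j * Real.exp (e * b j a))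
      fun j => mul_nonneg (hW j) (Real.exp_pos _).le
    refine ⟨fun i => if i = a then e else ε i, fun i => ?_, ?_⟩
    · by_cases h : i = a <;> simp [h, he, hε]
    · have hL : ∀ j, ∑ i ∈ insert a s, (if i = a then e else ε i) * b j i =
          e * b j a + ∑ i ∈ s, ε i * b j i := by
        intro j
        rw [Finset.sum_insert ha, if_pos rfl]
        congr 1
        refine Finset.sum_congr rfl fun i hi => ?_
        rw [if_neg (by rintro rfl; exact ha hi)]
      simp only [hL, Finset.sum_insert ha, Real.exp_add]
      calc _ = ∑ j ∈ J, W j * Real.exp (e * b j a) * Real.exp (∑ i ∈ s, ε i * b j i) := by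
            simp only [mul_assoc]
        _ ≤ _ := hsum
        _ = ∑ j ∈ J, V j * Real.exp (e * b j a) :=
            Finset.sum_congr rfl fun j _ => by rw [hV]; ring
        _ ≤ _ := hle
        _ = _ := Finset.sum_congr rfl fun j _ => by rw [hV]; ring

/-- A Chernoff bound with parameter `1`, giving `log` in place of its square root; polynomial losses
are harmless later. -/
theorem exists_signs_norm_sum_le {ι κ : Type*} [DecidableEq ι] (J : Finset κ) (c : κ → ι → ℂ)
    (s : Finset ι) (h : ∀ j ∈ J, ∑ i ∈ s, ‖c j i‖ ^ 2 ≤ 1) :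
    ∃ ε : ι → ℝ, (∀ i, ε i = 1 ∨ ε i = -1) ∧
      ∀ j ∈ J, ‖∑ i ∈ s, (ε i : ℂ) * c j i‖ ≤ 2 * Real.log (4 * J.card) + 1 := by
  -- The real parts of `u z`, for these four `u`, control the real and imaginary parts of `z` with
  -- both signs.
  set U : Finset ℂ := {1, -1, Complex.I, -Complex.I} with hU
  have hUcard : U.card ≤ 4 := Finset.card_le_four
  have hUn : ∀ u ∈ U, ‖u‖ = 1 := by
    intro u hu
    simp only [hU, Finset.mem_insert, Finset.mem_singleton] at hu
    rcases hu with rfl | rfl | rfl | rfl <;> simp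
  obtain ⟨ε, hε, hsum⟩ := exists_signs_sum_exp_le (J ×ˢ U)
    (fun ju i => (ju.2 * c ju.1 i).re) s (fun _ => 1) (fun _ => zero_le_one)
  refine ⟨ε, hε, fun j hj => ?_⟩
  have hJ : 0 < J.card := Finset.card_pos.2 ⟨j, hj⟩
  have htot : ∑ ju ∈ J ×ˢ U, (1 : ℝ) * Real.exp (∑ i ∈ s, (ju.2 * c ju.1 i).re ^ 2 / 2) ≤
      4 * J.card * Real.exp (1 / 2) := by
    calc _ ≤ ∑ ju ∈ J ×ˢ U, Real.exp (1 / 2) := by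
          refine Finset.sum_le_sum fun ju hju => ?_
          rw [one_mul, Real.exp_le_exp, ← Finset.sum_div]
          rw [Finset.mem_product] at hju
          gcongr
          refine le_trans (Finset.sum_le_sum fun i _ => ?_) (h ju.1 hju.1)
          rw [sq_le_sq, abs_of_nonneg (norm_nonneg _)]
          refine (Complex.abs_re_le_norm _).trans ?_
          rw [norm_mul, hUn _ hju.2, one_mul]
      _ = (J.card * U.card : ℕ) * Real.exp (1 / 2) := by
          rw [Finset.sum_const, Finset.card_product, nsmul_eq_mul]
      _ ≤ _ := by
          gcongr
          push_cast
          rw [mul_comm]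
          gcongr
          exact_mod_cast hUcard
  set z := ∑ i ∈ s, (ε i : ℂ) * c j i with hz
  have hre : ∀ u ∈ U, (u * z).re ≤ Real.log (4 * J.card) + 1 / 2 := by
    intro u hu
    have h1 : Real.exp ((u * z).re) ≤ 4 * J.card * Real.exp (1 / 2) := by
      refine le_trans ?_ (hsum.trans htot)
      have h2 := Finset.single_le_sum (s := J ×ˢ U)
        (f := fun ju => (1 : ℝ) * Real.exp (∑ i ∈ s, ε i * (ju.2 * c ju.1 i).re))
        (fun _ _ => by positivity) (Finset.mk_mem_product hj hu)
      refine le_of_eq_of_le ?_ h2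
      simp only [one_mul, hz, Finset.mul_sum, Complex.re_sum]
      congr 1
      refine Finset.sum_congr rfl fun i _ => ?_
      rw [mul_left_comm, Complex.re_ofReal_mul]
    have h4 : (0 : ℝ) < 4 * J.card := by positivity
    rw [← Real.log_exp (1 / 2), ← Real.log_mul h4.ne' (Real.exp_pos _).ne']
    exact (Real.le_log_iff_exp_le (by positivity)).2 h1
  have h1 := hre 1 (by simp [hU])
  have h2 := hre (-1) (by simp [hU])
  have h3 := hre Complex.I (by simp [hU])
  have h4 := hre (-Complex.I) (by simp [hU])
  simp only [one_mul, neg_mul, Complex.neg_re, Complex.I_mul_re, neg_neg] at h1 h2 h3 h4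
  have h5 := Complex.norm_le_abs_re_add_abs_im z
  have h6 : |z.re| ≤ Real.log (4 * J.card) + 1 / 2 := abs_le'.2 ⟨h1, h2⟩
  have h7 : |z.im| ≤ Real.log (4 * J.card) + 1 / 2 := abs_le'.2 ⟨h4, h3⟩
  linarith

/-! ### Discretisation of the ball -/

/-- Rounding toward zero does not increase moduli, so grid approximations stay in the ball of `ℓ_σ`.
-/
theorem exists_int_round_toward_zero {K : ℕ} (hK : 0 < K) {x : ℝ} (hx : |x| ≤ 1) :
    ∃ a ∈ Finset.Icc (-(K : ℤ)) K, |(a : ℝ) / K| ≤ |x| ∧ |x - a / K| ≤ 1 / K := by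
  have hK' : (0 : ℝ) < K := by exact_mod_cast hK
  have main : ∀ y : ℝ, 0 ≤ y → y ≤ 1 → ∃ a : ℤ, 0 ≤ a ∧ a ≤ K ∧ (a : ℝ) / K ≤ y ∧
      y - a / K ≤ 1 / K := by
    intro y hy0 hy1
    refine ⟨⌊y * K⌋, Int.floor_nonneg.2 (by positivity), ?_, ?_, ?_⟩
    · have : (⌊y * K⌋ : ℝ) ≤ K := (Int.floor_le _).trans (by nlinarith)
      exact_mod_cast this
    · rw [div_le_iff₀ hK']
      exact Int.floor_le _
    · rw [sub_le_iff_le_add, ← add_div, le_div_iff₀ hK']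
      linarith [Int.lt_floor_add_one (y * K)]
  rcases le_total 0 x with h0 | h0
  · rw [abs_of_nonneg h0] at hx ⊢
    obtain ⟨a, ha0, haK, h1, h2⟩ := main x h0 hx
    have ha' : (0 : ℝ) ≤ (a : ℝ) / K := by positivity
    refine ⟨a, Finset.mem_Icc.2 ⟨by omega, haK⟩, by rwa [abs_of_nonneg ha'], ?_⟩
    rw [abs_of_nonneg (by linarith)]
    exact h2
  · rw [abs_of_nonpos h0] at hx ⊢
    obtain ⟨a, ha0, haK, h1, h2⟩ := main (-x) (by linarith) hx
    have ha' : (0 : ℝ) ≤ (a : ℝ) / K := by positivity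
    refine ⟨-a, Finset.mem_Icc.2 ⟨by omega, by omega⟩, ?_, ?_⟩
    · rw [Int.cast_neg, neg_div, abs_neg, abs_of_nonneg ha']
      exact h1
    · rw [Int.cast_neg, neg_div, abs_of_nonpos (by linarith)]
      linarith

/-- The square grid of mesh `1/K` in the unit square of `ℂ`. -/
noncomputable def complexGrid (K : ℕ) : Finset ℂ :=
  (Finset.Icc (-(K : ℤ)) K ×ˢ Finset.Icc (-(K : ℤ)) K).image
    fun ab => ⟨(ab.1 : ℝ) / K, (ab.2 : ℝ) / K⟩

theorem card_complexGrid_le (K : ℕ) : (complexGrid K).card ≤ (2 * K + 1) ^ 2 := by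
  refine Finset.card_image_le.trans ?_
  rw [Finset.card_product, Int.card_Icc, sq]
  apply le_of_eq
  congr 1 <;> omega

theorem exists_mem_complexGrid {K : ℕ} (hK : 0 < K) {z : ℂ} (hz : ‖z‖ ≤ 1) :
    ∃ y ∈ complexGrid K, ‖y‖ ≤ ‖z‖ ∧ ‖z - y‖ ≤ 2 / K := by
  obtain ⟨a, ha, ha1, ha2⟩ := exists_int_round_toward_zero hK ((Complex.abs_re_le_norm z).trans hz)
  obtain ⟨b, hb, hb1, hb2⟩ := exists_int_round_toward_zero hK ((Complex.abs_im_le_norm z).trans hz)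
  refine ⟨⟨(a : ℝ) / K, (b : ℝ) / K⟩,
    Finset.mem_image.2 ⟨(a, b), Finset.mk_mem_product ha hb, rfl⟩, ?_, ?_⟩
  · rw [Complex.norm_def, Complex.norm_def]
    refine Real.sqrt_le_sqrt ?_
    rw [Complex.normSq_apply, Complex.normSq_apply]
    have h1 := sq_le_sq.2 ha1
    have h2 := sq_le_sq.2 hb1
    simp only
    nlinarith
  · refine (Complex.norm_le_abs_re_add_abs_im _).trans ?_
    simp only [Complex.sub_re, Complex.sub_im]
    calc _ ≤ 1 / (K : ℝ) + 1 / K := add_le_add ha2 hb2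
      _ = _ := by ring

theorem norm_pow_sub_pow_le_of_norm_le_one {a b : ℂ} (ha : ‖a‖ ≤ 1) (hb : ‖b‖ ≤ 1) (k : ℕ) :
    ‖a ^ k - b ^ k‖ ≤ k * ‖a - b‖ := by
  induction k with
  | zero => simp
  | succ k ih =>
    have : a ^ (k + 1) - b ^ (k + 1) = a ^ k * (a - b) + (a ^ k - b ^ k) * b := by ring
    rw [this]
    calc _ ≤ ‖a ^ k‖ * ‖a - b‖ + ‖a ^ k - b ^ k‖ * ‖b‖ := by
          refine (norm_add_le _ _).trans ?_
          rw [norm_mul, norm_mul]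
      _ ≤ 1 * ‖a - b‖ + (k * ‖a - b‖) * 1 := by
          gcongr
          rw [norm_pow]
          exact pow_le_one₀ (norm_nonneg _) ha
      _ = _ := by push_cast; ring

theorem norm_prod_pow_sub_prod_pow_le {ι : Type*} [DecidableEq ι] (s : Finset ι) {a b : ι → ℂ}
    (ha : ∀ i, ‖a i‖ ≤ 1) (hb : ∀ i, ‖b i‖ ≤ 1) {δ : ℝ} (hδ : ∀ i, ‖a i - b i‖ ≤ δ)
    (α : ι → ℕ) : ‖∏ i ∈ s, a i ^ α i - ∏ i ∈ s, b i ^ α i‖ ≤ (∑ i ∈ s, α i : ℕ) * δ := by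
  induction s using Finset.induction_on with
  | empty => simp
  | insert j s hj ih =>
    rw [Finset.prod_insert hj, Finset.prod_insert hj, Finset.sum_insert hj]
    have : a j ^ α j * ∏ i ∈ s, a i ^ α i - b j ^ α j * ∏ i ∈ s, b i ^ α i =
        a j ^ α j * (∏ i ∈ s, a i ^ α i - ∏ i ∈ s, b i ^ α i) +
          (a j ^ α j - b j ^ α j) * ∏ i ∈ s, b i ^ α i := by ring
    rw [this]
    calc _ ≤ ‖a j ^ α j‖ * ‖∏ i ∈ s, a i ^ α i - ∏ i ∈ s, b i ^ α i‖ +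
          ‖a j ^ α j - b j ^ α j‖ * ‖∏ i ∈ s, b i ^ α i‖ := by
          refine (norm_add_le _ _).trans ?_
          rw [norm_mul, norm_mul]
      _ ≤ 1 * ((∑ i ∈ s, α i : ℕ) * δ) + (α j * δ) * 1 := by
          gcongr
          · rw [norm_pow]
            exact pow_le_one₀ (norm_nonneg _) (ha j)
          · exact mul_nonneg (Nat.cast_nonneg _) ((norm_nonneg _).trans (hδ j))
          · exact (norm_pow_sub_pow_le_of_norm_le_one (ha j) (hb j) _).trans
              (mul_le_mul_of_nonneg_left (hδ j) (Nat.cast_nonneg _))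
          · simp only [norm_prod, norm_pow]
            exact Finset.prod_le_one (fun _ _ => by positivity)
              fun i _ => pow_le_one₀ (norm_nonneg _) (hb i)
      _ = _ := by push_cast; ring

/-! ### Polynomials with multinomial coefficients and small supremum -/

theorem multinomial_le_factorial {n m : ℕ} {α : Fin n → ℕ} (hα : ∑ i, α i = m) :
    Nat.multinomial Finset.univ α ≤ m.factorial := by
  have h := Nat.multinomial_spec Finset.univ α
  rw [hα] at h
  rw [← h]
  exact Nat.le_mul_of_pos_left _ (Finset.prod_pos fun i _ => Nat.factorial_pos _)

theorem sum_multinomial_eq {n : ℕ} (m : ℕ) :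
    ∑ α ∈ (Finset.univ.piAntidiag m : Finset (Fin n → ℕ)),
      (Nat.multinomial Finset.univ α : ℝ) = (n : ℝ) ^ m := by
  have := Finset.sum_pow_eq_sum_piAntidiag (Finset.univ : Finset (Fin n)) (fun _ => (1 : ℝ)) m
  simpa using this.symm

/-- The `ℓ_2` norm is at most the `ℓ_σ` norm as `σ ≤ 2`. In the `σ`-th powers, `σ - 1` of the
exponents on the multinomial coefficient are bounded by `m!`, and the rest sums by the multinomial
theorem. -/
theorem sum_sq_multinomial_mul_le {n m : ℕ} {σ : ℝ} (h1 : 1 ≤ σ) (h2 : σ ≤ 2) {y : Fin n → ℂ}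
    (hy : ∑ i, ‖y i‖ ^ σ ≤ 1) :
    ∑ α ∈ Finset.univ.piAntidiag m, (Nat.multinomial Finset.univ α * ∏ i, ‖y i‖ ^ α i) ^ 2 ≤
      ((m.factorial : ℝ) ^ (1 - 1 / σ)) ^ 2 := by
  set H : ℝ := (m.factorial : ℝ) ^ (1 - 1 / σ) with hH
  have hσ0 : 0 < σ := by linarith
  have hf : (0 : ℝ) < m.factorial := by exact_mod_cast m.factorial_pos
  have hH0 : 0 < H := by rw [hH]; positivity
  set a : (Fin n → ℕ) → ℝ := fun α => Nat.multinomial Finset.univ α * ∏ i, ‖y i‖ ^ α i with ha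
  have ha0 : ∀ α, 0 ≤ a α := fun α => by rw [ha]; positivity
  have hHσ : H ^ σ = (m.factorial : ℝ) ^ (σ - 1) := by
    rw [hH, ← Real.rpow_mul hf.le]
    congr 1
    field_simp
  have hsum : ∑ α ∈ Finset.univ.piAntidiag m, a α ^ σ ≤ H ^ σ := by
    calc _ ≤ ∑ α ∈ Finset.univ.piAntidiag m, (m.factorial : ℝ) ^ (σ - 1) *
          (Nat.multinomial Finset.univ α * ∏ i, (‖y i‖ ^ σ) ^ α i) := by
          refine Finset.sum_le_sum fun α hα => ?_
          have hα' : ∑ i, α i = m := by simpa using hα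
          have hμ : (0 : ℝ) < Nat.multinomial Finset.univ α := by
            exact_mod_cast Nat.multinomial_pos _ _
          have hpow : (∏ i, ‖y i‖ ^ α i) ^ σ = ∏ i, (‖y i‖ ^ σ) ^ α i := by
            rw [← Real.finsetProd_rpow _ _ fun i _ => by positivity]
            refine Finset.prod_congr rfl fun i _ => ?_
            rw [← Real.rpow_natCast, ← Real.rpow_natCast, ← Real.rpow_mul (norm_nonneg _),
              ← Real.rpow_mul (norm_nonneg _), mul_comm]
          have hμσ : (Nat.multinomial Finset.univ α : ℝ) ^ σ =
              (Nat.multinomial Finset.univ α : ℝ) ^ (σ - 1) * Nat.multinomial Finset.univ α := by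
            conv_rhs => rw [← Real.rpow_one (Nat.multinomial Finset.univ α : ℝ), ← Real.rpow_mul hμ.le, one_mul, ← Real.rpow_add hμ]
            congr 1
            ring
          rw [ha]
          simp only
          rw [Real.mul_rpow hμ.le (by positivity), hpow, hμσ, mul_assoc]
          gcongr
          exact_mod_cast multinomial_le_factorial hα'
      _ = (m.factorial : ℝ) ^ (σ - 1) * (∑ i, ‖y i‖ ^ σ) ^ m := by
          rw [← Finset.mul_sum, ← Finset.sum_pow_eq_sum_piAntidiag]
      _ ≤ (m.factorial : ℝ) ^ (σ - 1) * 1 := by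
          gcongr
          exact pow_le_one₀ (by positivity) hy
      _ = _ := by rw [mul_one, hHσ]
  have hsplit : ∀ t : ℝ, 0 ≤ t → t ^ 2 = t ^ σ * t ^ (2 - σ) := by
    intro t ht
    rw [← Real.rpow_add_of_nonneg ht hσ0.le (by linarith)]
    norm_num
  calc _ ≤ ∑ α ∈ Finset.univ.piAntidiag m, a α ^ σ * H ^ (2 - σ) := by
        refine Finset.sum_le_sum fun α hα => ?_
        have h3 : a α ≤ H := by
          have h4 : a α ^ σ ≤ H ^ σ := (Finset.single_le_sum (f := fun α => a α ^ σ)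
            (fun α _ => Real.rpow_nonneg (ha0 α) _) hα).trans hsum
          exact (Real.rpow_le_rpow_iff (ha0 α) hH0.le hσ0).1 h4
        change a α ^ 2 ≤ _
        rw [hsplit _ (ha0 α)]
        gcongr
    _ = (∑ α ∈ Finset.univ.piAntidiag m, a α ^ σ) * H ^ (2 - σ) := by rw [Finset.sum_mul]
    _ ≤ H ^ σ * H ^ (2 - σ) := by gcongr
    _ = _ := (hsplit H hH0.le).symm

theorem log_four_mul_pow_le {n m : ℕ} (hn : 2 ≤ n) (hm : 1 ≤ m) (hmn : m ≤ n) :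
    Real.log (4 * ((2 * ((2 * m * n ^ m : ℕ) : ℝ) + 1) ^ 2) ^ n) ≤ 5 * (n : ℝ) ^ 3 := by
  have hn' : (2 : ℝ) ≤ n := by exact_mod_cast hn
  have hm' : (1 : ℝ) ≤ m := by exact_mod_cast hm
  have hmn' : (m : ℝ) ≤ n := by exact_mod_cast hmn
  have hlog : ∀ x : ℝ, 0 < x → Real.log x ≤ x / 2 := fun x hx => log_le_half hx
  have hpow : (1 : ℝ) ≤ m * (n : ℝ) ^ m := by
    have : (1 : ℝ) ≤ (n : ℝ) ^ m := one_le_pow₀ (by linarith)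
    nlinarith
  have hbase : 2 * ((2 * m * n ^ m : ℕ) : ℝ) + 1 ≤ 5 * (m * (n : ℝ) ^ m) := by
    push_cast
    nlinarith
  calc _ ≤ Real.log (4 * ((5 * (m * (n : ℝ) ^ m)) ^ 2) ^ n) := by
        apply Real.log_le_log (by positivity)
        gcongr
    _ = Real.log 4 + n * (2 * (Real.log 5 + (Real.log m + m * Real.log n))) := by
        rw [Real.log_mul (by norm_num) (by positivity), Real.log_pow, Real.log_pow,
          Real.log_mul (by norm_num) (by positivity), Real.log_mul (by positivity) (by positivity),
          Real.log_pow]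
        push_cast
        ring
    _ ≤ 4 / 2 + n * (2 * (5 / 2 + (m / 2 + m * (n / 2)))) := by
        gcongr <;> exact hlog _ (by positivity)
    _ ≤ 4 / 2 + n * (2 * (5 / 2 + (n / 2 + n * (n / 2)))) := by gcongr
    _ ≤ _ := by nlinarith [mul_nonneg (sub_nonneg.2 hn') (sub_nonneg.2 hn'), pow_pos (by linarith : (0 : ℝ) < n) 2, mul_nonneg (mul_nonneg (sub_nonneg.2 hn') (sub_nonneg.2 hn')) (by linarith : (0 : ℝ) ≤ n)]

/-- A homogeneous polynomial with large coefficients and small supremum on `B_{ℓ_σ^n}`. -/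
theorem exists_signs_polynomial_norm_le {n m : ℕ} (hn : 2 ≤ n) (hm : 1 ≤ m) (hmn : m ≤ n)
    {σ : ℝ} (h1 : 1 ≤ σ) (h2 : σ ≤ 2) :
    ∃ ε : (Fin n → ℕ) → ℝ, (∀ α, ε α = 1 ∨ ε α = -1) ∧
      ∀ z : Fin n → ℂ, ∑ i, ‖z i‖ ^ σ ≤ 1 →
        ‖∑ α ∈ Finset.univ.piAntidiag m,
          (ε α * Nat.multinomial Finset.univ α : ℂ) * ∏ i, z i ^ α i‖ ≤
          (n : ℝ) ^ 7 * (m.factorial : ℝ) ^ (1 - 1 / σ) := by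
  set H : ℝ := (m.factorial : ℝ) ^ (1 - 1 / σ) with hH
  have hσ0 : 0 < σ := by linarith
  have hH1 : 1 ≤ H := Real.one_le_rpow (by exact_mod_cast m.factorial_pos)
    (sub_nonneg.2 (by rw [div_le_one hσ0]; exact h1))
  have hH0 : 0 < H := by linarith
  have hn' : (2 : ℝ) ≤ n := by exact_mod_cast hn
  have hm' : (1 : ℝ) ≤ m := by exact_mod_cast hm
  -- The mesh is chosen so that rounding changes the polynomial by at most `n^m · m · 2/K = 1`.
  set K : ℕ := 2 * m * n ^ m with hK
  have hK0 : 0 < K := by positivity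
  set J : Finset (Fin n → ℂ) :=
    (Fintype.piFinset fun _ : Fin n => complexGrid K).filter fun y => ∑ i, ‖y i‖ ^ σ ≤ 1 with hJ
  have hJcard : J.card ≤ ((2 * K + 1) ^ 2) ^ n := by
    refine (Finset.card_filter_le _ _).trans ?_
    rw [Fintype.card_piFinset_const]
    gcongr
    exact card_complexGrid_le K
  obtain ⟨ε, hε, hb⟩ := exists_signs_norm_sum_le J
    (fun y α => ((Nat.multinomial Finset.univ α : ℂ) * ∏ i, y i ^ α i) / (H : ℂ))
    (Finset.univ.piAntidiag m) (fun y hy => by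
      have hy' : ∑ i, ‖y i‖ ^ σ ≤ 1 := (Finset.mem_filter.1 hy).2
      have := sum_sq_multinomial_mul_le (m := m) h1 h2 hy'
      simp only [norm_div, norm_mul, Complex.norm_natCast, norm_prod, norm_pow, Complex.norm_real,
        Real.norm_of_nonneg hH0.le, div_pow]
      rw [← Finset.sum_div, div_le_one (by positivity)]
      exact this)
  refine ⟨ε, hε, fun z hz => ?_⟩
  have hεn : ∀ α, ‖(ε α : ℂ)‖ = 1 := by
    intro α
    rcases hε α with h | h <;> simp [h]
  have hz1 : ∀ i, ‖z i‖ ≤ 1 := by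
    intro i
    have h3 : ‖z i‖ ^ σ ≤ 1 := (Finset.single_le_sum (f := fun i => ‖z i‖ ^ σ)
      (fun i _ => by positivity) (Finset.mem_univ i)).trans hz
    by_contra h4
    exact absurd h3 (not_le.2 (Real.one_lt_rpow (not_le.1 h4) hσ0))
  choose y hyK hyz hyd using fun i => exists_mem_complexGrid hK0 (hz1 i)
  have hyJ : y ∈ J := by
    refine Finset.mem_filter.2 ⟨Fintype.mem_piFinset.2 hyK, le_trans ?_ hz⟩
    gcongr with i
    exact hyz i
  set P : (Fin n → ℂ) → ℂ := fun z => ∑ α ∈ Finset.univ.piAntidiag m,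
    (ε α * Nat.multinomial Finset.univ α : ℂ) * ∏ i, z i ^ α i with hP
  change ‖P z‖ ≤ _
  have hdiff : ‖P z - P y‖ ≤ 1 := by
    rw [hP]
    simp only
    rw [← Finset.sum_sub_distrib]
    calc _ ≤ ∑ α ∈ (Finset.univ.piAntidiag m : Finset (Fin n → ℕ)),
          (Nat.multinomial Finset.univ α : ℝ) * (m * (2 / K)) := by
          refine norm_sum_le_of_le _ fun α hα => ?_
          have hα' : ∑ i, α i = m := by simpa using hα
          rw [← mul_sub, norm_mul, norm_mul, hεn, one_mul, Complex.norm_natCast]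
          gcongr
          have := norm_prod_pow_sub_prod_pow_le Finset.univ hz1
            (fun i => (hyz i).trans (hz1 i)) hyd α
          rwa [hα'] at this
      _ = (n : ℝ) ^ m * (m * (2 / K)) := by rw [← Finset.sum_mul, sum_multinomial_eq]
      _ = 1 := by
          rw [hK]
          push_cast
          field_simp
      _ ≤ 1 := le_rfl
  have hPy : ‖P y‖ ≤ H * (2 * Real.log (4 * J.card) + 1) := by
    have h3 := hb y hyJ
    have h4 : ∑ α ∈ Finset.univ.piAntidiag m,
        (ε α : ℂ) * (((Nat.multinomial Finset.univ α : ℂ) * ∏ i, y i ^ α i) / (H : ℂ)) =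
        P y / H := by
      rw [hP, Finset.sum_div]
      exact Finset.sum_congr rfl fun α _ => by ring
    rw [h4, norm_div, Complex.norm_real, Real.norm_of_nonneg hH0.le, div_le_iff₀ hH0] at h3
    linarith
  have hJ0 : 0 < J.card := Finset.card_pos.2 ⟨y, hyJ⟩
  have hlog : Real.log (4 * J.card) ≤ 5 * (n : ℝ) ^ 3 := by
    refine le_trans (Real.log_le_log (by positivity) ?_) (log_four_mul_pow_le hn hm hmn)
    gcongr
    exact_mod_cast hJcard
  have hn7 : 2 * (5 * (n : ℝ) ^ 3) + 1 + 1 ≤ (n : ℝ) ^ 7 := by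
    have h3 : (8 : ℝ) ≤ (n : ℝ) ^ 3 := by
      calc (8 : ℝ) = 2 ^ 3 := by norm_num
        _ ≤ _ := by gcongr
    have h4 : (16 : ℝ) ≤ (n : ℝ) ^ 4 := by
      calc (16 : ℝ) = 2 ^ 4 := by norm_num
        _ ≤ _ := by gcongr
    have : (n : ℝ) ^ 7 = (n : ℝ) ^ 3 * (n : ℝ) ^ 4 := by ring
    nlinarith
  calc ‖P z‖ ≤ ‖P y‖ + ‖P z - P y‖ := by
        simpa using norm_add_le (P y) (P z - P y)
    _ ≤ H * (2 * (5 * (n : ℝ) ^ 3) + 1) + H * 1 := by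
        refine add_le_add (hPy.trans ?_) (hdiff.trans (by linarith))
        gcongr
    _ = H * (2 * (5 * (n : ℝ) ^ 3) + 1 + 1) := by ring
    _ ≤ H * (n : ℝ) ^ 7 := by gcongr
    _ = _ := mul_comm _ _

/-- Hölder's inequality, for the inclusion of the ball of `ℓ_q` in a multiple of that of `ℓ_σ`. -/
theorem sum_norm_rpow_le_of_lq_norm_le_one {n : ℕ} (hn : 1 ≤ n) {q : ℝ≥0∞} [hq : Fact (1 ≤ q)]
    {σ : ℝ} (hσ : 1 ≤ σ) (hσq : ENNReal.ofReal σ ≤ q) {z : PiLp q (fun _ : Fin n => ℂ)}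
    (hz : ‖z‖ ≤ 1) : ∑ i, ‖z i‖ ^ σ ≤ (n : ℝ) ^ (1 - σ * recip q) := by
  have hσ0 : 0 < σ := by linarith
  have hn0 : (0 : ℝ) < n := by exact_mod_cast hn
  rcases eq_or_ne q ∞ with rfl | hq'
  · rw [linfty_norm_le_one_iff] at hz
    calc ∑ i, ‖z i‖ ^ σ ≤ ∑ _i : Fin n, (1 : ℝ) :=
          Finset.sum_le_sum fun i _ => Real.rpow_le_one (norm_nonneg _) (hz i) hσ0.le
      _ = _ := by simp [recip]
  · have h1 := one_le_toReal_of_ne_top hq.out hq'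
    set Q := q.toReal with hQ
    have hQ0 : 0 < Q := by linarith
    rw [lq_norm_le_one_iff hq'] at hz
    have hσQ : σ ≤ Q := (ENNReal.ofReal_le_iff_le_toReal hq').1 hσq
    have hr : 1 ≤ Q / σ := by rwa [le_div_iff₀ hσ0, one_mul]
    have hH := Real.rpow_sum_le_const_mul_sum_rpow Finset.univ (fun i => ‖z i‖ ^ σ) hr
    have hS : 0 ≤ ∑ i, ‖z i‖ ^ σ := by positivity
    have habs : ∀ i, |‖z i‖ ^ σ| = ‖z i‖ ^ σ := fun i => abs_of_nonneg (by positivity)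
    simp only [habs, Finset.card_univ, Fintype.card_fin] at hH
    have hpow : ∀ i, (‖z i‖ ^ σ) ^ (Q / σ) = ‖z i‖ ^ Q := by
      intro i
      rw [← Real.rpow_mul (norm_nonneg _), mul_div_cancel₀ _ hσ0.ne']
    simp only [hpow] at hH
    have hH2 : (∑ i, ‖z i‖ ^ σ) ^ (Q / σ) ≤ (n : ℝ) ^ (Q / σ - 1) :=
      hH.trans (mul_le_of_le_one_right (by positivity) hz)
    calc ∑ i, ‖z i‖ ^ σ = ((∑ i, ‖z i‖ ^ σ) ^ (Q / σ)) ^ (σ / Q) := by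
          rw [← Real.rpow_mul hS, div_mul_div_cancel₀ hσ0.ne', div_self hQ0.ne', Real.rpow_one]
      _ ≤ ((n : ℝ) ^ (Q / σ - 1)) ^ (σ / Q) := by gcongr
      _ = _ := by
          rw [← Real.rpow_mul hn0.le, recip_eq_inv_toReal, ← hQ]
          congr 1
          field_simp

theorem exists_signs_polynomial_norm_le_lq {n m : ℕ} (hn : 2 ≤ n) (hm : 1 ≤ m) (hmn : m ≤ n)
    {q : ℝ≥0∞} [hq : Fact (1 ≤ q)] {σ : ℝ} (h1 : 1 ≤ σ) (h2 : σ ≤ 2)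
    (hσq : ENNReal.ofReal σ ≤ q) :
    ∃ ε : (Fin n → ℕ) → ℝ, (∀ α, ε α = 1 ∨ ε α = -1) ∧
      ∀ z : PiLp q (fun _ : Fin n => ℂ), ‖z‖ ≤ 1 →
        ‖∑ α ∈ Finset.univ.piAntidiag m,
          (ε α * Nat.multinomial Finset.univ α : ℂ) * ∏ i, z i ^ α i‖ ≤
          ((n : ℝ) ^ (1 / σ - recip q)) ^ m *
            ((n : ℝ) ^ 7 * (m.factorial : ℝ) ^ (1 - 1 / σ)) := by
  obtain ⟨ε, hε, hb⟩ := exists_signs_polynomial_norm_le hn hm hmn h1 h2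
  refine ⟨ε, hε, fun z hz => ?_⟩
  have hσ0 : 0 < σ := by linarith
  have hn0 : (0 : ℝ) < n := by exact_mod_cast (by omega : 0 < n)
  set ρ : ℝ := (n : ℝ) ^ (1 / σ - recip q) with hρ
  have hρ0 : 0 < ρ := by positivity
  have hρσ : ρ ^ σ = (n : ℝ) ^ (1 - σ * recip q) := by
    rw [hρ, ← Real.rpow_mul hn0.le]
    congr 1
    field_simp
  have hz' := sum_norm_rpow_le_of_lq_norm_le_one (by omega) h1 hσq hz
  have h3 := hb (fun i => z i / (ρ : ℂ)) (by
    simp only [norm_div, Complex.norm_real, Real.norm_of_nonneg hρ0.le]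
    simp only [Real.div_rpow (norm_nonneg _) hρ0.le]
    rw [← Finset.sum_div, hρσ]
    exact div_le_one_of_le₀ hz' (by positivity))
  have h4 : ∑ α ∈ Finset.univ.piAntidiag m,
      (ε α * Nat.multinomial Finset.univ α : ℂ) * ∏ i, (z i / (ρ : ℂ)) ^ α i =
      (∑ α ∈ Finset.univ.piAntidiag m,
        (ε α * Nat.multinomial Finset.univ α : ℂ) * ∏ i, z i ^ α i) / (ρ : ℂ) ^ m := by
    rw [Finset.sum_div]
    refine Finset.sum_congr rfl fun α hα => ?_
    have : ∑ i, α i = m := by simpa using hα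
    simp only [div_pow, Finset.prod_div_distrib, Finset.prod_pow_eq_pow_sum, this]
    ring
  rw [h4, norm_div, norm_pow, Complex.norm_real, Real.norm_of_nonneg hρ0.le,
    div_le_iff₀ (by positivity)] at h3
  linarith

/-! ### The upper estimate -/

theorem isHolomorphicWithExpansion_sum {X : Type*} [NormedAddCommGroup X] [NormedSpace ℂ X]
    {n : ℕ} {q : ℝ≥0∞} [Fact (1 ≤ q)] (s : Finset (Fin n → ℕ)) {x : (Fin n → ℕ) → X}
    (hx : ∀ α ∉ s, x α = 0) :
    IsHolomorphicWithExpansion n q (fun z => ∑ α ∈ s, monomialAt z α • x α) x := by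
  refine ⟨?_, fun z _ => hasSum_sum_of_ne_finset_zero fun α hα => by simp [hx α hα]⟩
  have : Differentiable ℂ
      (fun z : PiLp q (fun _ : Fin n => ℂ) => ∑ α ∈ s, monomialAt z α • x α) := by
    unfold monomialAt
    fun_prop
  exact this.differentiableOn

/-- Comparison of the `ℓ_p`-sum of the multinomial coefficients with their sum. -/
theorem mul_pow_rpow_le_sum_multinomial {n m : ℕ} {c p : ℝ} (hc : 0 ≤ c) (hp : 1 ≤ p) :
    ((c * n) ^ m) ^ p ≤ ((n : ℝ) ^ m) ^ (p - 1) *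
      ∑ α ∈ (Finset.univ.piAntidiag m : Finset (Fin n → ℕ)),
        (c ^ m * Nat.multinomial Finset.univ α) ^ p := by
  have hH := Real.rpow_sum_le_const_mul_sum_rpow (Finset.univ.piAntidiag m : Finset (Fin n → ℕ))
    (fun α => c ^ m * (Nat.multinomial Finset.univ α : ℝ)) hp
  have habs : ∀ α : Fin n → ℕ, |c ^ m * (Nat.multinomial Finset.univ α : ℝ)| =
    c ^ m * (Nat.multinomial Finset.univ α : ℝ) := fun α => abs_of_nonneg (by positivity)
  simp only [habs] at hH
  rw [← Finset.mul_sum, sum_multinomial_eq, ← mul_pow] at hH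
  refine hH.trans ?_
  -- There are at most `n^m` monomials, since the multinomial coefficients are at least `1` and add
  -- up to `n^m`.
  gcongr
  rw [← sum_multinomial_eq]
  calc _ = ∑ α ∈ (Finset.univ.piAntidiag m : Finset (Fin n → ℕ)), (1 : ℝ) := by simp
    _ ≤ _ := by
      gcongr with α
      exact_mod_cast Nat.multinomial_pos _ _

/-- The admissibility inequality is tested on the signed polynomial times a unit vector, at a
multiple of the diagonal point. -/
theorem IsBohrAdmissible.multinomial_le {X : Type*} [NormedAddCommGroup X] [NormedSpace ℂ X]
    [Nontrivial X] {p lam : ℝ} (hp : 1 ≤ p) (hlam : 1 < lam) {n m : ℕ} (hn : 2 ≤ n) (hm : 1 ≤ m)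
    (hmn : m ≤ n) {q : ℝ≥0∞} [hq : Fact (1 ≤ q)] {σ : ℝ} (h1 : 1 ≤ σ) (h2 : σ ≤ 2)
    (hσq : ENNReal.ofReal σ ≤ q) {r : ℝ≥0}
    (hr : IsBohrAdmissible p n q (ContinuousLinearMap.id ℂ X) lam r) :
    ((r / 2 * (1 / (n : ℝ)) ^ recip q * n) ^ m) ^ p ≤ ((n : ℝ) ^ m) ^ (p - 1) *
      (lam * (((n : ℝ) ^ (1 / σ - recip q)) ^ m *
            ((n : ℝ) ^ 7 * (m.factorial : ℝ) ^ (1 - 1 / σ))) ^ p) := by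
  have hp0 : 0 < p := by linarith
  have hn0 : (0 : ℝ) < n := by exact_mod_cast (by omega : 0 < n)
  obtain ⟨ε, hε, hb⟩ := exists_signs_polynomial_norm_le_lq hn hm hmn (q := q) h1 h2 hσq
  set Mb : ℝ := ((n : ℝ) ^ (1 / σ - recip q)) ^ m *
            ((n : ℝ) ^ 7 * (m.factorial : ℝ) ^ (1 - 1 / σ)) with hMb
  have hMb0 : 0 ≤ Mb := by positivity
  obtain ⟨e, he⟩ : ∃ e : X, ‖e‖ = 1 := exists_norm_eq X zero_le_one
  set x : (Fin n → ℕ) → X := fun α => if α ∈ (Finset.univ.piAntidiag m : Finset (Fin n → ℕ)) then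
    (ε α * Nat.multinomial Finset.univ α : ℂ) • e else 0 with hx
  have hεn : ∀ α, ‖(ε α : ℂ)‖ = 1 := by
    intro α
    rcases hε α with h | h <;> simp [h]
  have hadm := hr _ x (isHolomorphicWithExpansion_sum (q := q) (Finset.univ.piAntidiag m) (x := x)
    fun α hα => by rw [hx]; exact if_neg hα)
  set c : ℝ := r / 2 * (1 / (n : ℝ)) ^ recip q with hc
  have hc0 : 0 ≤ c := by positivity
  -- The factor `1/2` moves the diagonal unit vector into the open ball.
  set w : PiLp q (fun _ : Fin n => ℂ) := (1 / 2 : ℂ) •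
    WithLp.toLp q (fun _ => (((1 / (n : ℝ)) ^ recip q : ℝ) : ℂ)) with hw
  have hw1 : ‖w‖ < 1 := by
    have := lq_norm_rpow_recip_le_one (q := q) (t := fun _ : Fin n => 1 / (n : ℝ))
      (fun _ => by positivity) (by simp [hn0.ne'])
    rw [hw, norm_smul]
    norm_num
    norm_num at this
    linarith
  have hlow : ENNReal.ofReal (∑ α ∈ (Finset.univ.piAntidiag m : Finset (Fin n → ℕ)),
        (c ^ m * Nat.multinomial Finset.univ α) ^ p) ≤
      ⨆ z ∈ ((r : ℝ) : ℂ) • lqBall n q,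
        ∑' α : Fin n → ℕ, ‖monomialAt z α • ContinuousLinearMap.id ℂ X (x α)‖ₑ ^ p := by
    refine le_trans ?_ (le_iSup₂ (f := fun (z : PiLp q (fun _ : Fin n => ℂ))
      (_ : z ∈ ((r : ℝ) : ℂ) • lqBall n q) =>
        ∑' α : Fin n → ℕ, ‖monomialAt z α • ContinuousLinearMap.id ℂ X (x α)‖ₑ ^ p)
      (((r : ℝ) : ℂ) • w) (Set.smul_mem_smul_set (by simpa [lqBall] using hw1)))
    refine le_trans (le_of_eq ?_) (ENNReal.sum_le_tsum (Finset.univ.piAntidiag m))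
    rw [ENNReal.ofReal_sum_of_nonneg fun _ _ => by positivity]
    refine Finset.sum_congr rfl fun α hα => ?_
    have hα' : ∑ i, α i = m := by simpa using hα
    rw [← ENNReal.ofReal_rpow_of_nonneg (by positivity) hp0.le, ← ofReal_norm]
    congr 2
    have hmon : monomialAt (((r : ℝ) : ℂ) • w) α = (c : ℂ) ^ m := by
      simp only [monomialAt, hw, PiLp.smul_apply, smul_eq_mul, Finset.prod_pow_eq_pow_sum, hα']
      congr 1
      rw [hc]
      push_cast
      ring
    rw [hmon, norm_smul, ContinuousLinearMap.id_apply, hx]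
    simp only
    rw [if_pos hα, norm_smul, norm_mul, hεn, he, Complex.norm_natCast, norm_pow,
      Complex.norm_real, Real.norm_of_nonneg hc0]
    ring
  have hup : (⨆ z ∈ lqBall n q,
      ‖∑ α ∈ Finset.univ.piAntidiag m, monomialAt z α • x α‖ₑ ^ p) ≤
      ENNReal.ofReal (Mb ^ p) := by
    refine iSup₂_le fun z hz => ?_
    have hz1 : ‖z‖ ≤ 1 := by
      have : ‖z‖ < 1 := by simpa [lqBall] using hz
      exact this.le
    rw [← ENNReal.ofReal_rpow_of_nonneg hMb0 hp0.le, ← ofReal_norm]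
    gcongr
    have : ∑ α ∈ Finset.univ.piAntidiag m, monomialAt z α • x α =
        (∑ α ∈ Finset.univ.piAntidiag m,
          (ε α * Nat.multinomial Finset.univ α : ℂ) * ∏ i, z i ^ α i) • e := by
      rw [Finset.sum_smul]
      refine Finset.sum_congr rfl fun α hα => ?_
      rw [hx]
      simp only
      rw [if_pos hα, smul_smul, monomialAt, mul_comm]
    rw [this, norm_smul, he, mul_one]
    exact hb z hz1
  have hfin : ENNReal.ofReal (∑ α ∈ (Finset.univ.piAntidiag m : Finset (Fin n → ℕ)),
        (c ^ m * Nat.multinomial Finset.univ α) ^ p) ≤ ENNReal.ofReal (lam * Mb ^ p) := by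
    rw [ENNReal.ofReal_mul (by linarith)]
    exact hlow.trans (hadm.trans (by gcongr))
  rw [ENNReal.ofReal_le_ofReal_iff (by positivity)] at hfin
  refine (mul_pow_rpow_le_sum_multinomial hc0 hp).trans ?_
  gcongr

/-- The constant is `2 · 3 · e^7`: `2` from halving the test point, `3` from `m ≤ 3 log n`, and
`e^7` from the `m`-th root of `n^7`. -/
theorem IsBohrAdmissible.le_upper {X : Type*} [NormedAddCommGroup X] [NormedSpace ℂ X]
    [Nontrivial X] {p lam : ℝ} (hp : 1 ≤ p) (hlam : 1 < lam) {n : ℕ} (hn : 2 ≤ n)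
    {q : ℝ≥0∞} [hq : Fact (1 ≤ q)] {r : ℝ≥0}
    (hr : IsBohrAdmissible p n q (ContinuousLinearMap.id ℂ X) lam r) :
    (r : ℝ) ≤ 6 * Real.exp 7 * lam ^ (2 / p) * (n : ℝ) ^ (1 - 1 / p) *
      (Real.log n / n) ^ (1 - recip (min q 2)) := by
  have hp0 : 0 < p := by linarith
  have hn' : (2 : ℝ) ≤ n := by exact_mod_cast hn
  have hn0 : (0 : ℝ) < n := by linarith
  set L := Real.log n with hL
  have hLhalf : 1 / 2 ≤ L := by
    have : Real.log 2 ≤ L := Real.log_le_log two_pos hn'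
    linarith [Real.log_two_gt_d9]
  have hL0 : 0 < L := by linarith
  -- This degree is large enough for `n^{7/m}` to be bounded, and small enough for `m` to be
  -- comparable with `log n`.
  set m : ℕ := ⌈L⌉₊ with hm
  have hLm : L ≤ m := Nat.le_ceil L
  have hm1 : 1 ≤ m := Nat.one_le_ceil_iff.2 hL0
  have hmL : (m : ℝ) ≤ 3 * L := by
    have := Nat.ceil_lt_add_one hL0.le
    linarith
  have hmn : m ≤ n := by
    refine Nat.ceil_le.2 ?_
    have := log_le_half hn0
    linarith
  set σ : ℝ := (min q 2).toReal with hσ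
  have hmin : min q 2 ≠ ∞ := ne_top_of_le_ne_top ENNReal.ofNat_ne_top (min_le_right q 2)
  have hσ1 : 1 ≤ σ := one_le_toReal_of_ne_top (le_min hq.out one_le_two) hmin
  have hσ2 : σ ≤ 2 := by
    have := ENNReal.toReal_mono ENNReal.ofNat_ne_top (min_le_right q 2)
    simpa using this
  have hσq : ENNReal.ofReal σ ≤ q := by
    rw [hσ, ENNReal.ofReal_toReal hmin]
    exact min_le_left q 2
  have hrec : recip (min q 2) = 1 / σ := by rw [recip_eq_inv_toReal, one_div]
  rw [hrec]
  have hσ' : 0 ≤ 1 - 1 / σ := sub_nonneg.2 (by rw [div_le_one (by linarith)]; exact hσ1)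
  have hσ'1 : 1 - 1 / σ ≤ 1 := by
    have : 0 ≤ 1 / σ := by positivity
    linarith
  have key := hr.multinomial_le hp hlam hn hm1 hmn hσ1 hσ2 hσq
  set ρ : ℝ := (n : ℝ) ^ (1 / σ - recip q) with hρ
  set c : ℝ := r / 2 * (1 / (n : ℝ)) ^ recip q with hc
  have hc0 : 0 ≤ c := by positivity
  set H : ℝ := (m.factorial : ℝ) ^ (1 - 1 / σ) with hH
  have hlam0 : 0 < lam := by linarith
  have hroot : (c * n) ^ m ≤
      ((n : ℝ) ^ m) ^ (1 - 1 / p) * (lam ^ (1 / p) * (ρ ^ m * ((n : ℝ) ^ 7 * H))) := by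
    rw [← Real.rpow_le_rpow_iff (by positivity) (by positivity) hp0]
    refine key.trans (le_of_eq ?_)
    rw [Real.mul_rpow (x := ((n : ℝ) ^ m) ^ (1 - 1 / p)) (by positivity) (by positivity),
      Real.mul_rpow (x := lam ^ (1 / p)) (by positivity) (by positivity), ← Real.rpow_mul (by positivity), ← Real.rpow_mul hlam0.le,
      one_div_mul_cancel hp0.ne', Real.rpow_one]
    congr 2
    field_simp
  have hnexp : (n : ℝ) ^ 7 ≤ Real.exp 7 ^ m := by
    calc (n : ℝ) ^ 7 = Real.exp L ^ 7 := by rw [hL, Real.exp_log hn0]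
      _ = Real.exp (7 * L) := by rw [← Real.exp_nat_mul]; norm_num
      _ ≤ Real.exp (m * 7) := by rw [Real.exp_le_exp]; linarith
      _ = _ := Real.exp_nat_mul _ _
  have hHm : H ≤ ((m : ℝ) ^ (1 - 1 / σ)) ^ m := by
    calc H ≤ ((m : ℝ) ^ m) ^ (1 - 1 / σ) := by
          rw [hH]
          gcongr
          exact_mod_cast Nat.factorial_le_pow m
      _ = _ := by
          rw [← Real.rpow_natCast, ← Real.rpow_natCast, ← Real.rpow_mul (by positivity),
            ← Real.rpow_mul (by positivity), mul_comm]
  have hlam1 : 1 ≤ lam ^ (1 / p) := Real.one_le_rpow hlam.le (by positivity)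
  have hpow : (c * n) ^ m ≤ ((n : ℝ) ^ (1 - 1 / p) *
      (lam ^ (1 / p) * (ρ * (Real.exp 7 * (m : ℝ) ^ (1 - 1 / σ))))) ^ m := by
    refine hroot.trans ?_
    have h1 : ((n : ℝ) ^ m) ^ (1 - 1 / p) = ((n : ℝ) ^ (1 - 1 / p)) ^ m := by
      rw [← Real.rpow_natCast, ← Real.rpow_natCast, ← Real.rpow_mul (by positivity),
            ← Real.rpow_mul (by positivity), mul_comm]
    rw [h1, mul_pow, mul_pow, mul_pow, mul_pow]
    gcongr
    -- The `m`-th root of the factor `λ^{1/p}` is not exploited: `λ^{1/p}` itself already suffices.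
    exact le_self_pow₀ hlam1 (by omega)
  have hcn : c * n ≤ (n : ℝ) ^ (1 - 1 / p) *
      (lam ^ (1 / p) * (ρ * (Real.exp 7 * (m : ℝ) ^ (1 - 1 / σ)))) :=
    (pow_le_pow_iff_left₀ (by positivity) (by positivity) (by omega)).1 hpow
  have hcn2 : c * n = r / 2 * (n : ℝ) ^ (1 - recip q) := by
    rw [hc, one_div, Real.inv_rpow hn0.le, Real.rpow_sub hn0, Real.rpow_one]
    ring
  have hρ2 : ρ = (n : ℝ) ^ (1 - recip q) * ((n : ℝ) ^ (1 - 1 / σ))⁻¹ := by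
    rw [hρ, ← Real.rpow_neg hn0.le, ← Real.rpow_add hn0]
    congr 1
    ring
  set N : ℝ := (n : ℝ) ^ (1 - recip q) with hN
  have hN0 : 0 < N := by positivity
  rw [hcn2, hρ2] at hcn
  have hr2 : (r : ℝ) / 2 ≤ (n : ℝ) ^ (1 - 1 / p) *
      (lam ^ (1 / p) * (((n : ℝ) ^ (1 - 1 / σ))⁻¹ * (Real.exp 7 * (m : ℝ) ^ (1 - 1 / σ)))) := by
    refine le_of_mul_le_mul_right (hcn.trans (le_of_eq ?_)) hN0
    ring
  have hmn3 : ((n : ℝ) ^ (1 - 1 / σ))⁻¹ * (m : ℝ) ^ (1 - 1 / σ) ≤ 3 * (L / n) ^ (1 - 1 / σ) := by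
    calc _ ≤ ((n : ℝ) ^ (1 - 1 / σ))⁻¹ * (3 * L) ^ (1 - 1 / σ) := by gcongr
      _ = 3 ^ (1 - 1 / σ) * (L / n) ^ (1 - 1 / σ) := by
          rw [Real.mul_rpow (by norm_num) hL0.le, Real.div_rpow hL0.le hn0.le]
          ring
      _ ≤ _ := by
          gcongr
          calc (3 : ℝ) ^ (1 - 1 / σ) ≤ 3 ^ (1 : ℝ) :=
                Real.rpow_le_rpow_of_exponent_le (by norm_num) hσ'1
            _ = 3 := Real.rpow_one 3
  have hlam2 : lam ^ (1 / p) ≤ lam ^ (2 / p) :=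
    Real.rpow_le_rpow_of_exponent_le hlam.le (by gcongr; norm_num)
  calc (r : ℝ) = 2 * (r / 2) := by ring
    _ ≤ 2 * ((n : ℝ) ^ (1 - 1 / p) * (lam ^ (1 / p) *
        (((n : ℝ) ^ (1 - 1 / σ))⁻¹ * (Real.exp 7 * (m : ℝ) ^ (1 - 1 / σ))))) := by gcongr
    _ = 2 * Real.exp 7 * lam ^ (1 / p) * (n : ℝ) ^ (1 - 1 / p) *
        (((n : ℝ) ^ (1 - 1 / σ))⁻¹ * (m : ℝ) ^ (1 - 1 / σ)) := by ring
    _ ≤ 2 * Real.exp 7 * lam ^ (2 / p) * (n : ℝ) ^ (1 - 1 / p) *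
        (3 * (L / n) ^ (1 - 1 / σ)) := by gcongr
    _ = _ := by ring

/-! ### Both estimates together -/

theorem mainTheorem2 :
    ∃ B : ℝ, 0 < B ∧
      ∀ (X : Type*) [NormedAddCommGroup X] [NormedSpace ℂ X] [FiniteDimensional ℂ X]
        [Nontrivial X],
        0 < bohrLowerConst X ∧
        ∀ (lam p : ℝ), 1 < lam → 1 ≤ p →
        ∀ (q : ℝ≥0∞) [Fact (1 ≤ q)] (n : ℕ), 1 ≤ n →
          (2 ≤ n →
            bohrRadiusSpace p n q X lam ≤
              ENNReal.ofReal (B * lam ^ (2 / p) * (n : ℝ) ^ (1 - 1 / p) *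
                (Real.log n / n) ^ (1 - recip (min q 2)))) ∧
          (q ≤ bohrExponent p q →
            bohrLowerConst X *
                ENNReal.ofReal (((lam - 1) / (2 * lam - 1)) ^ (1 / p) *
                  (Real.log n / n) ^ (1 - recip (bohrExponent p q))) ≤
              bohrRadiusSpace p n q X lam) ∧
          (bohrExponent p q < q →
            bohrLowerConst X *
                ENNReal.ofReal (((lam - 1) / (2 * lam - 1)) ^ (1 / p) *
                  (n : ℝ) ^ (recip q - recip (bohrExponent p q)) *
                  (Real.log n / n) ^ (1 - recip (bohrExponent p q))) ≤
              bohrRadiusSpace p n q X lam) := by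
  refine ⟨6 * Real.exp 7, by positivity, fun X _ _ _ _ => ⟨bohrLowerConst_pos X, ?_⟩⟩
  intro lam p hlam hp q hq n hn
  have hp0 : 0 < p := by linarith
  have hrec := recip_bohrExponent hp hq.out
  have hκ : 0 ≤ 1 - recip q := sub_nonneg.2 (recip_le_one hq.out)
  have hdiv : (1 - recip q) / p ≤ 1 - recip q := div_le_self hκ hp
  have hexp : 1 - recip (bohrExponent p q) = (1 - recip q) / p := by rw [hrec]; ring
  refine ⟨fun hn2 => iSup₂_le fun r hr => ?_, fun _ => ?_, fun _ => ?_⟩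
  · rw [← ENNReal.ofReal_coe_nnreal]
    exact ENNReal.ofReal_le_ofReal (hr.le_upper hp hlam hn2)
  · have h := bohrLowerConst_mul_le_bohrRadiusSpace X hn (q := q) hp hlam le_rfl
    rwa [Real.rpow_zero, mul_one, ← hexp] at h
  -- The exponent `1/q - 1/r` is nonpositive because `(1-1/q)/p ≤ 1 - 1/q`.
  · have h := bohrLowerConst_mul_le_bohrRadiusSpace X hn (q := q) hp hlam
      (E := recip q - recip (bohrExponent p q)) (by linarith)
    rwa [← hexp] at h
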